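/- Let $(\Omega,\mathcal F,P)$ be a probability space with a filtration $(\mathcal F_t)_{0\le t\le T}$ such that $\mathcal F_0$ contains all $P$-zero sets of $\mathcal F$, let $(S_t)_{0\le t\le T}$ be an adapted $\mathbb R^d$-valued process and $\Delta S_t=S_t-S_{t-1}$. Let $\Xi_t$ be the set of $\mathcal F_t$-measurable $\mathbb R^d$-valued random variables. Conditional expectations are generalized ones, $E(X|\mathcal H)=E(X^+|\mathcal H)-E(X^-|\mathcal H)\in[-\infty,\infty]$, well defined when a.s. the two terms are not both infinite; likewise $EX=EX^+-EX^-$. Let $U:\mathbb R\to\mathbb R$ be concave and nondecreasing with $U(0)=0$, and let $\tilde x>0$ and $0<\gamma<1$ be such that $U(\lambda x)\le\lambda^\gamma U(x)$ for all $x\ge\tilde x$ and $\lambda\ge1$. Assume absence of arbitrage: if $\phi_t\in\Xi_{t-1}$ for $1\le t\le T$ and $\sum_{t=1}^T\langle\phi_t,\Delta S_t\rangle\ge0$ a.s., then $\sum_{t=1}^T\langle\phi_t,\Delta S_t\rangle=0$ a.s. The dynamic value functions are given by $U_T(x)=U(x)$ and, for $0\le t<T$ and $x\in\mathbb R$, $$U_t(x)=\operatorname*{ess\,sup}_{\xi\in\Xi_t}E\big(U_{t+1}(x+\langle\xi,\Delta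 S_{t+1}\rangle)\,\big|\,\mathcal F_t\big).$$ Here $U_{t+1}$ on the right-hand side is a regular version, that is, a finite random function which is $\mathcal F_{t+1}$-measurable for each fixed $x$ and whose paths are a.s. nondecreasing and concave in $x$ (such a version is unique up to indistinguishability). Assume that these functions are well defined and finite from above: for every $0\le t<T$ and every choice of regular versions of $U_{t+1},\dots,U_T$, for all $x\in\mathbb R$, the conditional expectation above is well defined for every $\xi\in\Xi_t$ and $U_t(x)<\infty$ a.s.; moreover $EU_0(x)<\infty$ for all $x\in\mathbb R$ (for every choice of regular versions). Then there is a constant $C>0$ such that, for all $x\in\mathbb R$ and $\lambda\ge1$, $$U(\lambda x)\le\lambda U(x)+C\lambda^\gamma,\qquad U(\lambda x)\le\lambda^\gamma U(x)+C\lambda^\gamma,\tag{G}$$ and the value functions $U_t$, $0\le t\le T$, have finite versions, $\mathcal F_t$-measurable for each $x$, such that: 1. for each $t$, almost surely, $x\mapsto U_t(x)$ is nondecreasing and concave; 2. for every $C>0$ for which $U$ satisfies (G) and for each $t$, almost surely, $U_t(\lambda x)\le\lambda U_t(x)+C\lambda^\gamma$ and $U_t(\lambda x)\le\lambda^\gamma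 U_t(x)+C\lambda^\gamma$ for all $x\in\mathbb R$ and $\lambda\ge1$; 3. $EU_t(x)>-\infty$ and $U_t(x)<\infty$ for all $x\in\mathbb R$ and $0\le t\le T$; 4. there are $\mathcal B(\mathbb R)\otimes\mathcal F_t$-measurable functions $\tilde\xi_{t+1}:\mathbb R\times\Omega\to\mathbb R^d$, $0\le t<T$, such that for every $x\in\mathbb R$, a.s., $$U_t(x)=E\big(U_{t+1}(x+\langle\tilde\xi_{t+1}(x),\Delta S_{t+1}\rangle)\,\big|\,\mathcal F_t\big),$$ so that one function $\tilde\xi_{t+1}$ attains the essential supremum in the recursion for all $x$. -/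

import Mathlib

open MeasureTheory Filter
open scoped ENNReal

noncomputable section

namespace UtilityMax

/-- The utility function `U : ℝ → ℝ` is concave, nondecreasing, `U 0 = 0`, and
`U (l * x) ≤ l ^ γ * U x` for all `x ≥ xt` and `l ≥ 1`, where `xt > 0` and `0 < γ < 1`. -/
structure IsUtility (U : ℝ → ℝ) (xt γ : ℝ) : Prop where
  concave : ConcaveOn ℝ Set.univ U
  mono : Monotone U
  zero : U 0 = 0
  xt_pos : 0 < xt
  γ_pos : 0 < γ
  γ_lt_one : γ < 1
  elasticity : ∀ x, xt ≤ x → ∀ l : ℝ, 1 ≤ l → U (l * x) ≤ l ^ γ * U x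

/-- The two growth inequalities with exponent `γ` and constant `C`. -/
def Growth (γ C : ℝ) (V : ℝ → ℝ) : Prop :=
  ∀ x l : ℝ, 1 ≤ l → V (l * x) ≤ l * V x + C * l ^ γ ∧ V (l * x) ≤ l ^ γ * V x + C * l ^ γ

variable {Ω : Type*}

/-- Extended expectation `E X = E X⁺ - E X⁻` of a real random variable, with values in `[-∞, ∞]`.
In `EReal` one has `∞ - ∞ = -∞`, so that `-∞ < eExp P X` holds exactly when `E X⁻ < ∞`. -/
def eExp [MeasurableSpace Ω] (P : Measure Ω) (X : Ω → ℝ) : EReal :=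
  ((∫⁻ ω, ENNReal.ofReal (X ω) ∂P : ℝ≥0∞) : EReal)
    - ((∫⁻ ω, ENNReal.ofReal (-X ω) ∂P : ℝ≥0∞) : EReal)

/-- Generalized conditional expectation `E(X|m) = E(X⁺|m) - E(X⁻|m)`, with values in `[-∞, ∞]`,
built from conditional expectations of nonnegative random variables (which always exist). -/
def genCondExp {mΩ : MeasurableSpace Ω} (m : MeasurableSpace Ω) (P : Measure[mΩ] Ω)
    (X : Ω → ℝ) : Ω → EReal := fun ω =>
  ((condLExp m P (fun ω' => ENNReal.ofReal (X ω')) ω : ℝ≥0∞) : EReal)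
    - ((condLExp m P (fun ω' => ENNReal.ofReal (-X ω')) ω : ℝ≥0∞) : EReal)

/-- The generalized conditional expectation is well defined: almost surely, `E(X⁺|m)` and
`E(X⁻|m)` are not both infinite. -/
def GenCondExpWellDefined {mΩ : MeasurableSpace Ω} (m : MeasurableSpace Ω) (P : Measure[mΩ] Ω)
    (X : Ω → ℝ) : Prop :=
  ∀ᵐ ω ∂P, condLExp m P (fun ω' => ENNReal.ofReal (X ω')) ω < ∞ ∨
    condLExp m P (fun ω' => ENNReal.ofReal (-X ω')) ω < ∞

/-- `G` is (a version of) the essential supremum of the family `f` of extended random variables: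
the almost surely least random variable dominating every member of the family almost surely. -/
structure IsEssSupFamily [MeasurableSpace Ω] (P : Measure Ω) {ι : Type*} (f : ι → Ω → EReal)
    (G : Ω → EReal) : Prop where
  measurable : Measurable G
  le : ∀ i, f i ≤ᵐ[P] G
  least : ∀ H : Ω → EReal, Measurable H → (∀ i, f i ≤ᵐ[P] H) → G ≤ᵐ[P] H

variable {d : ℕ}

/-- Value at time `t` of the portfolio `φ` with initial capital `c`, for the price process `S`:
`c + ∑_{i=1}^t ⟨φ_i, S_i - S_{i-1}⟩`. -/
def portfolioValue (S : ℕ → Ω → EuclideanSpace ℝ (Fin d)) (c : ℝ)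
    (φ : ℕ → Ω → EuclideanSpace ℝ (Fin d)) (t : ℕ) (ω : Ω) : ℝ :=
  c + ∑ i ∈ Finset.range t, inner ℝ (φ (i + 1) ω) (S (i + 1) ω - S i ω)

/-- Absence of arbitrage up to time `T`, over all predictable strategies `φ_1, …, φ_T`
(`φ_t` is `ℱ_{t-1}`-measurable). -/
def NoArbitrage [mΩ : MeasurableSpace Ω] (P : Measure Ω) (ℱ : Filtration ℕ mΩ)
    (S : ℕ → Ω → EuclideanSpace ℝ (Fin d)) (T : ℕ) : Prop :=
  ∀ φ : ℕ → Ω → EuclideanSpace ℝ (Fin d), (∀ t < T, Measurable[ℱ t] (φ (t + 1))) →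
    (∀ᵐ ω ∂P, 0 ≤ portfolioValue S 0 φ T ω) → ∀ᵐ ω ∂P, portfolioValue S 0 φ T ω = 0

/-- For a random function `V` (the value function of time `t + 1`), the random variable
`ω ↦ V(x + ⟨ξ(ω), S_{t+1}(ω) - S_t(ω)⟩, ω)`. -/
def nextValue (S : ℕ → Ω → EuclideanSpace ℝ (Fin d)) (t : ℕ) (V : ℝ → Ω → ℝ) (x : ℝ)
    (ξ : Ω → EuclideanSpace ℝ (Fin d)) (ω : Ω) : ℝ :=
  V (x + inner ℝ (ξ ω) (S (t + 1) ω - S t ω)) ω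

/-- `G` is a version of `ess sup_ξ E(V(x + ⟨ξ, ΔS_{t+1}⟩) | ℱ_t)`, where `ξ` ranges over all
`ℱ_t`-measurable `d`-dimensional random variables. -/
def IsBellmanSup [mΩ : MeasurableSpace Ω] (P : Measure Ω) (ℱ : Filtration ℕ mΩ)
    (S : ℕ → Ω → EuclideanSpace ℝ (Fin d)) (t : ℕ) (V : ℝ → Ω → ℝ) (x : ℝ)
    (G : Ω → EReal) : Prop :=
  IsEssSupFamily P
    (fun ξ : {ξ : Ω → EuclideanSpace ℝ (Fin d) // Measurable[ℱ t] ξ} =>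
      genCondExp (ℱ t) P (nextValue S t V x ξ.1)) G

/-- `u_s, …, u_T` are regular versions of the dynamic value functions `U_s, …, U_T`.
Each `u_t` is a finite random function, `u_t(x)` is `ℱ_t`-measurable for every `x`, almost every
path of `u_t` is nondecreasing and concave, `u_T = U`, and for `s ≤ t < T` and every `x`, `u_t(x)`
is a version of `ess sup_ξ E(u_{t+1}(x + ⟨ξ, ΔS_{t+1}⟩) | ℱ_t)`.

The recursion evaluates the random function of time `t + 1` at a random point, so it is meaningful
only once a regular version of that function has been fixed. Versions with nondecreasing concave,
hence continuous, paths are unique up to indistinguishability. -/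
structure IsRegularValue [mΩ : MeasurableSpace Ω] (P : Measure Ω) (ℱ : Filtration ℕ mΩ)
    (S : ℕ → Ω → EuclideanSpace ℝ (Fin d)) (T : ℕ) (U : ℝ → ℝ) (s : ℕ)
    (u : ℕ → ℝ → Ω → ℝ) : Prop where
  terminal : ∀ x ω, u T x ω = U x
  adapted : ∀ t, s ≤ t → t ≤ T → ∀ x, Measurable[ℱ t] (u t x)
  mono : ∀ t, s ≤ t → t ≤ T → ∀ᵐ ω ∂P, Monotone (fun x => u t x ω)
  concave : ∀ t, s ≤ t → t ≤ T → ∀ᵐ ω ∂P, ConcaveOn ℝ Set.univ (fun x => u t x ω)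
  bellman : ∀ t, s ≤ t → t < T → ∀ x,
    IsBellmanSup P ℱ S t (u (t + 1)) x (fun ω => (u t x ω : EReal))

/-- The value functions are well defined and finite from above: going backwards from `T`, once
regular versions of `U_{t+1}, …, U_T` are fixed (no matter which ones), all the conditional
expectations in the definition of `U_t(x)` are well defined and `U_t(x)`, their essential
supremum, is almost surely `< ∞`, for every `x`; finally `E U_0(x) < ∞` for every `x`. -/
structure ValueWellPosed [mΩ : MeasurableSpace Ω] (P : Measure Ω) (ℱ : Filtration ℕ mΩ)
    (S : ℕ → Ω → EuclideanSpace ℝ (Fin d)) (T : ℕ) (U : ℝ → ℝ) : Prop where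
  wellDefined : ∀ t < T, ∀ u, IsRegularValue P ℱ S T U (t + 1) u → ∀ x,
    ∀ ξ : Ω → EuclideanSpace ℝ (Fin d), Measurable[ℱ t] ξ →
      GenCondExpWellDefined (ℱ t) P (nextValue S t (u (t + 1)) x ξ)
  lt_top : ∀ t < T, ∀ u, IsRegularValue P ℱ S T U (t + 1) u → ∀ x,
    ∀ G : Ω → EReal, IsBellmanSup P ℱ S t (u (t + 1)) x G → ∀ᵐ ω ∂P, G ω < ⊤
  exp_lt_top : ∀ u, IsRegularValue P ℱ S T U 0 u → ∀ x, eExp P (u 0 x) < ⊤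

end UtilityMax

end

/-!
In a one-period model without arbitrage, directions of strategies along which the gain vanishes
almost surely can be projected away, and every remaining direction loses with positive probability.
A concave utility that is unbounded below loses at least linearly in the size of a losing position,
whereas by the growth inequality with `γ < 1` it gains sublinearly. Expected utility is therefore
coercive in the position, and an optimal position exists. If the utility is bounded below, it is
constant and there is nothing to optimize.

The multi-period problem reduces to this one: given `ℱ_t`, the pair consisting of the path of the
next value function and the price increment has a regular conditional law on `C(ℝ, ℝ) × ℝᵈ`, and a
measurable selection of optimizers depends jointly measurably on the initial capital and on the
scenario. The paths of the new value function inherit monotonicity, concavity, the growth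
inequalities, the lower bound `U` and unboundedness below, so the step can be iterated backwards.
-/

open ProbabilityTheory Topology

namespace UtilityMax

theorem concaveOn_apply_mul_le {f : ℝ → ℝ} (hf : ConcaveOn ℝ Set.univ f) (hf0 : 0 ≤ f 0) {l : ℝ}
    (hl : 1 ≤ l) (x : ℝ) : f (l * x) ≤ l * f x := by
  have hl0 : 0 < l := by linarith
  have hl1 : 0 ≤ 1 - l⁻¹ := sub_nonneg.2 (inv_le_one_of_one_le₀ hl)
  have hconc := hf.2 (Set.mem_univ (l * x)) (Set.mem_univ 0) (by positivity : 0 ≤ l⁻¹) hl1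
    (by ring)
  simp only [smul_eq_mul, mul_zero, add_zero, inv_mul_cancel_left₀ hl0.ne'] at hconc
  exact (inv_mul_le_iff₀ hl0).1 (by nlinarith)

theorem IsUtility.exists_growth {U : ℝ → ℝ} {xt γ : ℝ} (hU : IsUtility U xt γ) :
    ∃ C : ℝ, 0 < C ∧ Growth γ C U := by
  have hmul {l : ℝ} (hl : 1 ≤ l) (x : ℝ) : U (l * x) ≤ l * U x :=
    concaveOn_apply_mul_le hU.concave hU.zero.ge hl x
  have hpos {x : ℝ} (hx : 0 ≤ x) : 0 ≤ U x := hU.zero ▸ hU.mono hx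
  have hxt : 0 ≤ U xt := hpos hU.xt_pos.le
  refine ⟨U xt + 1, by linarith, fun x l hl => ?_⟩
  have hl0 : 0 < l := by linarith
  have hlγ : 0 < l ^ γ := Real.rpow_pos_of_pos hl0 γ
  refine ⟨(hmul hl x).trans (by nlinarith), ?_⟩
  rcases le_total xt x with hx | hx
  · exact (hU.elasticity x hx l hl).trans (by nlinarith)
  rcases le_total 0 x with hx0 | hx0
  · calc U (l * x) ≤ U (l * xt) := hU.mono (by gcongr)
      _ ≤ l ^ γ * U xt := hU.elasticity xt le_rfl l hl
      _ ≤ l ^ γ * U x + (U xt + 1) * l ^ γ := by nlinarith [hpos hx0]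
  · have hUx : U x ≤ 0 := hU.zero ▸ hU.mono hx0
    have hγl : l ^ γ ≤ l := by simpa using Real.rpow_le_rpow_of_exponent_le hl hU.γ_lt_one.le
    have := hmul hl x
    nlinarith

section ExtendedExpectation

variable {Θ : Type*} [MeasurableSpace Θ] {μ : Measure Θ} {h k : Θ → ℝ}

theorem integrable_of_lintegral_ofReal_ne_top (hh : Measurable h)
    (hpos : ∫⁻ θ, ENNReal.ofReal (h θ) ∂μ ≠ ∞) (hneg : ∫⁻ θ, ENNReal.ofReal (-h θ) ∂μ ≠ ∞) :
    Integrable h μ := by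
  refine ⟨hh.aestronglyMeasurable, ?_⟩
  calc ∫⁻ θ, ‖h θ‖ₑ ∂μ ≤ ∫⁻ θ, (ENNReal.ofReal (h θ) + ENNReal.ofReal (-h θ)) ∂μ := by
        refine lintegral_mono fun θ => ?_
        rw [Real.enorm_eq_ofReal_abs]
        rcases abs_choice (h θ) with habs | habs <;> rw [habs]
        exacts [le_self_add, le_add_self]
    _ = ∫⁻ θ, ENNReal.ofReal (h θ) ∂μ + ∫⁻ θ, ENNReal.ofReal (-h θ) ∂μ :=
        lintegral_add_left hh.ennreal_ofReal _
    _ < ∞ := ENNReal.add_lt_top.2 ⟨hpos.lt_top, hneg.lt_top⟩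

theorem eExp_of_integrable (hh : Integrable h μ) : eExp μ h = (∫ θ, h θ ∂μ : ℝ) := by
  have hneg : ∫⁻ θ, ENNReal.ofReal (-h θ) ∂μ ≠ ∞ := hh.neg.lintegral_lt_top.ne
  rw [eExp, integral_eq_lintegral_pos_part_sub_lintegral_neg_part hh, EReal.coe_sub,
    EReal.coe_ennreal_toReal hh.lintegral_lt_top.ne, EReal.coe_ennreal_toReal hneg]

theorem integrable_of_bot_lt_eExp (hh : Measurable h)
    (hpos : ∫⁻ θ, ENNReal.ofReal (h θ) ∂μ ≠ ∞) (hbot : ⊥ < eExp μ h) : Integrable h μ := by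
  refine integrable_of_lintegral_ofReal_ne_top hh hpos fun hneg => hbot.ne' ?_
  rw [eExp, hneg, EReal.coe_ennreal_top, EReal.sub_top]

theorem coe_le_eExp_iff (hh : Measurable h) (hpos : ∫⁻ θ, ENNReal.ofReal (h θ) ∂μ ≠ ∞) {c : ℝ} :
    (c : EReal) ≤ eExp μ h ↔ Integrable h μ ∧ c ≤ ∫ θ, h θ ∂μ := by
  constructor
  · intro hc
    have hint := integrable_of_bot_lt_eExp hh hpos ((EReal.bot_lt_coe c).trans_le hc)
    exact ⟨hint, by simpa [eExp_of_integrable hint] using hc⟩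
  · rintro ⟨hint, hc⟩
    simpa [eExp_of_integrable hint] using hc

theorem eExp_mono_ae (hle : h ≤ᵐ[μ] k) : eExp μ h ≤ eExp μ k := by
  refine EReal.sub_le_sub (EReal.coe_ennreal_le_coe_ennreal_iff.2 (lintegral_mono_ae ?_))
    (EReal.coe_ennreal_le_coe_ennreal_iff.2 (lintegral_mono_ae ?_))
  · exact hle.mono fun θ hθ => ENNReal.ofReal_le_ofReal hθ
  · exact hle.mono fun θ hθ => ENNReal.ofReal_le_ofReal (neg_le_neg hθ)

theorem ofReal_max_neg_natCast (a : ℝ) (n : ℕ) :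
    ENNReal.ofReal (max a (-n)) = ENNReal.ofReal a := by
  rw [ENNReal.ofReal_max, ENNReal.ofReal_of_nonpos (neg_nonpos.2 n.cast_nonneg)]
  exact max_eq_left zero_le

theorem ofReal_neg_max_neg_natCast (a : ℝ) (n : ℕ) :
    ENNReal.ofReal (-max a (-n)) = min (ENNReal.ofReal (-a)) n := by
  rw [← min_neg_neg, neg_neg, ENNReal.ofReal_min, ENNReal.ofReal_natCast]

theorem integrable_max_neg [IsFiniteMeasure μ] (hh : Measurable h)
    (hpos : ∫⁻ θ, ENNReal.ofReal (h θ) ∂μ ≠ ∞) (n : ℕ) :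
    Integrable (fun θ => max (h θ) (-n)) μ := by
  refine integrable_of_lintegral_ofReal_ne_top (hh.max measurable_const) ?_ (ne_of_lt ?_)
  · simpa only [ofReal_max_neg_natCast] using hpos
  calc ∫⁻ θ, ENNReal.ofReal (-max (h θ) (-n)) ∂μ
      ≤ ∫⁻ _, n ∂μ := lintegral_mono fun θ => by
        rw [ofReal_neg_max_neg_natCast]; exact min_le_right _ _
    _ < ∞ := by
        rw [lintegral_const]
        exact ENNReal.mul_lt_top (ENNReal.natCast_lt_top n) (measure_lt_top μ _)

theorem tendsto_eExp_max_neg (hh : Measurable h) (hpos : ∫⁻ θ, ENNReal.ofReal (h θ) ∂μ ≠ ∞) :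
    Tendsto (fun n : ℕ => eExp μ fun θ => max (h θ) (-n)) atTop (𝓝 (eExp μ h)) := by
  have hlim : Tendsto (fun n : ℕ => ∫⁻ θ, min (ENNReal.ofReal (-h θ)) n ∂μ) atTop
      (𝓝 (∫⁻ θ, ENNReal.ofReal (-h θ) ∂μ)) := by
    refine lintegral_tendsto_of_tendsto_of_monotone
      (fun n => (hh.neg.ennreal_ofReal.min measurable_const).aemeasurable)
      (Eventually.of_forall fun θ m n hmn => min_le_min_left _ (Nat.cast_le.2 hmn))
      (Eventually.of_forall fun θ => ?_)
    simpa using tendsto_const_nhds.min ENNReal.tendsto_nat_nhds_top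
  simp only [eExp, ofReal_max_neg_natCast, ofReal_neg_max_neg_natCast, sub_eq_add_neg]
  have hcont := EReal.continuousAt_add (p := (((∫⁻ θ, ENNReal.ofReal (h θ) ∂μ : ℝ≥0∞) : EReal),
    -((∫⁻ θ, ENNReal.ofReal (-h θ) ∂μ : ℝ≥0∞) : EReal))) (Or.inl (by simpa using hpos))
    (Or.inl (by simp))
  exact hcont.tendsto.comp (tendsto_const_nhds.prodMk_nhds
    ((continuous_coe_ennreal_ereal.tendsto _).comp hlim).neg)

theorem eExp_eq_iInf_integral_max [IsFiniteMeasure μ] (hh : Measurable h)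
    (hpos : ∫⁻ θ, ENNReal.ofReal (h θ) ∂μ ≠ ∞) :
    eExp μ h = ⨅ n : ℕ, ((∫ θ, max (h θ) (-n) ∂μ : ℝ) : EReal) := by
  have hmax (n : ℕ) := eExp_of_integrable (integrable_max_neg hh hpos n)
  refine le_antisymm (le_iInf fun n => ?_) (ge_of_tendsto' (tendsto_eExp_max_neg hh hpos) ?_)
  · exact hmax n ▸ eExp_mono_ae (Eventually.of_forall fun θ => le_max_left _ _)
  · exact fun n => hmax n ▸ iInf_le _ n

theorem bot_lt_eExp_of_le [IsFiniteMeasure μ] {c : ℝ} (hc : ∀ᵐ θ ∂μ, c ≤ h θ) :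
    ⊥ < eExp μ h :=
  calc ⊥ < eExp μ fun _ => c := by
        rw [eExp_of_integrable (integrable_const c)]
        exact EReal.bot_lt_coe _
    _ ≤ eExp μ h := eExp_mono_ae hc

end ExtendedExpectation

section EssentialSupremum

variable {Θ ι : Type*} [MeasurableSpace Θ] (P : Measure Θ) [IsFiniteMeasure P]

theorem exists_countable_ae_cover {A : ι → Set Θ} (hA : ∀ i, MeasurableSet (A i)) :
    ∃ J : Set ι, J.Countable ∧ ∀ i, P (A i \ ⋃ j ∈ J, A j) = 0 := by
  let M (J : {J : Set ι // J.Countable}) : ℝ≥0∞ := P (⋃ j ∈ J.1, A j)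
  obtain ⟨s, -, hs, hmem⟩ := exists_seq_tendsto_sSup (S := Set.range M)
    ⟨_, ⟨⟨∅, Set.countable_empty⟩, rfl⟩⟩ (OrderTop.bddAbove _)
  choose J hJ using hmem
  have hcount : (⋃ n, (J n).1).Countable := Set.countable_iUnion fun n => (J n).2
  refine ⟨⋃ n, (J n).1, hcount, fun i => ?_⟩
  set B : Set Θ := ⋃ j ∈ ⋃ n, (J n).1, A j with hB
  have hsup : sSup (Set.range M) ≤ P B := le_of_tendsto' hs fun n => hJ n ▸
    measure_mono (Set.biUnion_subset_biUnion_left (Set.subset_iUnion (fun n => (J n).1) n))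
  have hle : P (A i ∪ B) ≤ sSup (Set.range M) :=
    le_sSup ⟨⟨insert i (⋃ n, (J n).1), hcount.insert i⟩, by simp only [M, Set.biUnion_insert, hB]⟩
  have hmax : P (A i \ B) + P B ≤ 0 + P B := by
    rw [zero_add, ← measure_union Set.disjoint_sdiff_left
      (MeasurableSet.biUnion hcount fun j _ => hA j), Set.sdiff_union_self]
    exact hle.trans hsup
  exact le_antisymm ((ENNReal.add_le_add_iff_right (measure_ne_top P B)).1 hmax) zero_le

theorem exists_isEssSupFamily {f : ι → Θ → EReal} (hf : ∀ i, Measurable (f i)) :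
    ∃ G, IsEssSupFamily P f G := by
  choose J hJc hJ using fun r : ℚ => exists_countable_ae_cover P
    (A := fun i => {θ | ((r : ℝ) : EReal) < f i θ})
    fun i => measurableSet_lt measurable_const (hf i)
  have hcount : (⋃ r, J r).Countable := Set.countable_iUnion hJc
  refine ⟨fun θ => ⨆ j ∈ ⋃ r, J r, f j θ, Measurable.biSup _ hcount fun i _ => hf i, fun i => ?_,
    fun H _ hle => ?_⟩
  · have hcover : ∀ᵐ θ ∂P, ∀ r : ℚ, θ ∉ {θ | ((r : ℝ) : EReal) < f i θ} \
        ⋃ j ∈ J r, {θ | ((r : ℝ) : EReal) < f j θ} :=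
      ae_all_iff.2 fun r => measure_eq_zero_iff_ae_notMem.1 (hJ r i)
    filter_upwards [hcover] with θ hθ
    by_contra! hlt
    obtain ⟨r, hr, hri⟩ := EReal.exists_rat_btwn_of_lt hlt
    refine hθ r ⟨hri, fun hmem => ?_⟩
    simp only [Set.mem_iUnion] at hmem
    obtain ⟨j, hj, hrj⟩ := hmem
    exact (hrj.trans_le (le_iSup₂_of_le j (Set.mem_iUnion.2 ⟨r, hj⟩) le_rfl)).not_gt hr
  · filter_upwards [(ae_ball_iff hcount).2 fun j _ => hle j] with θ hθ
    exact iSup₂_le hθ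

end EssentialSupremum

section Selection

theorem mapClusterPt_of_frequently_dist_lt {E : Type*} [PseudoMetricSpace E] {p q : ℕ → E} {x : E}
    {r : ℕ → ℝ} (hq : Tendsto q atTop (𝓝 x)) (hr : Tendsto r atTop (𝓝 0))
    (hfreq : ∀ m, ∃ᶠ n in atTop, dist (p n) (q m) < r m) : MapClusterPt x atTop p := by
  rw [mapClusterPt_iff_frequently]
  intro s hs
  obtain ⟨ε, hε, hεs⟩ := Metric.mem_nhds_iff.1 hs
  obtain ⟨m, hqm, hrm⟩ := ((Metric.tendsto_nhds.1 hq _ (half_pos hε)).and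
    (hr.eventually (gt_mem_nhds (half_pos hε)))).exists
  refine (hfreq m).mono fun n hn => hεs ?_
  calc dist (p n) x ≤ dist (p n) (q m) + dist (q m) x := dist_triangle _ _ _
    _ < ε := by linarith

variable {A E : Type*} [MeasurableSpace A] [MetricSpace E]
  [SecondCountableTopology E] [MeasurableSpace E]

theorem exists_measurable_near_maximizer {K : Set E} (hK : IsCompact K) (hne : K.Nonempty)
    {G : A → E → ℝ} (hm : ∀ z, Measurable fun a => G a z) (hc : ∀ a, Continuous (G a))
    {ε : ℝ} (hε : 0 < ε) :
    ∃ p : A → E, Measurable p ∧ (∀ a, p a ∈ K) ∧ ∀ a, ∀ z ∈ K, G a z - ε ≤ G a (p a) := by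
  classical
  have : Nonempty K := hne.to_subtype
  let D := TopologicalSpace.denseSeq K
  have hD : DenseRange D := TopologicalSpace.denseRange_denseSeq K
  have hex (a : A) : ∃ k, ∀ j, G a (D j) - ε ≤ G a (D k) := by
    obtain ⟨z, hz, hmax⟩ := hK.exists_isMaxOn hne (hc a).continuousOn
    obtain ⟨k, hk⟩ := hD.exists_mem_open (s := {w : K | G a z - ε < G a w})
      (isOpen_lt continuous_const ((hc a).comp continuous_subtype_val)) ⟨⟨z, hz⟩, by simp [hε]⟩
    exact ⟨k, fun j => (sub_le_sub_right (hmax (D j).2) ε).trans hk.le⟩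
  refine ⟨fun a => D (Nat.find (hex a)), ?_, fun a => (D _).2, fun a z hz => ?_⟩
  · refine (measurable_from_top (f := fun k => (D k : E))).comp (measurable_find hex fun k => ?_)
    rw [Set.ofPred_forall]
    exact MeasurableSet.iInter fun j => measurableSet_le ((hm _).sub measurable_const) (hm _)
  · have hcl : IsClosed {w : K | G a w - ε ≤ G a (D (Nat.find (hex a)))} :=
      isClosed_le (((hc a).comp continuous_subtype_val).sub continuous_const) continuous_const
    exact hcl.closure_subset_iff.2 (Set.range_subset_iff.2 (Nat.find_spec (hex a))) (hD ⟨z, hz⟩)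

variable [BorelSpace E]

theorem measurableSet_frequently_dist_lt {p : ℕ → A → E} (hp : ∀ n, Measurable (p n))
    {q : A → E} (hq : Measurable q) (ε : ℝ) :
    MeasurableSet {a | ∃ᶠ n in atTop, dist (p n a) (q a) < ε} := by
  simp only [frequently_atTop, Set.ofPred_forall, Set.ofPred_exists, Set.ofPred_and]
  exact MeasurableSet.iInter fun N => MeasurableSet.iUnion fun n =>
    (MeasurableSet.const _).inter (measurableSet_lt ((hp n).dist hq) measurable_const)

theorem exists_measurable_nearer_point {K : Set E} (hK : IsCompact K) {p : ℕ → A → E}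
    (hp : ∀ n, Measurable (p n)) (hpK : ∀ n a, p n a ∈ K) {q : A → E} (hq : Measurable q)
    {ε δ : ℝ} (hδ : 0 < δ) (hfreq : ∀ a, ∃ᶠ n in atTop, dist (p n a) (q a) < ε) :
    ∃ q' : A → E, Measurable q' ∧ (∀ a, ∃ᶠ n in atTop, dist (p n a) (q' a) < δ) ∧
      ∀ a, dist (q a) (q' a) < ε + δ := by
  classical
  rcases isEmpty_or_nonempty E with hE | hE
  · exact ⟨q, hq, fun a => (hE.false (q a)).elim, fun a => (hE.false (q a)).elim⟩
  let D := TopologicalSpace.denseSeq E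
  have hD : DenseRange D := TopologicalSpace.denseRange_denseSeq E
  have hex (a : A) : ∃ k, (∃ᶠ n in atTop, dist (p n a) (D k) < δ) ∧ dist (q a) (D k) < ε + δ := by
    obtain ⟨z, ⟨-, hzq⟩, hz⟩ := (hK.inter_right
      (Metric.isClosed_closedBall (x := q a) (ε := ε))).exists_mapClusterPt_of_frequently
      (l := atTop) (f := fun n => p n a) ((hfreq a).mono fun n hn => ⟨hpK n a, hn.le⟩)
    obtain ⟨k, hk⟩ := hD.exists_dist_lt z hδ
    refine ⟨k, mapClusterPt_iff_frequently.1 hz (Metric.ball (D k) δ)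
      (Metric.isOpen_ball.mem_nhds hk), ?_⟩
    calc dist (q a) (D k) ≤ dist (q a) z + dist z (D k) := dist_triangle _ _ _
      _ < ε + δ := add_lt_add_of_le_of_lt (by rwa [dist_comm]) hk
  refine ⟨fun a => D (Nat.find (hex a)), ?_, fun a => (Nat.find_spec (hex a)).1,
    fun a => (Nat.find_spec (hex a)).2⟩
  exact (measurable_from_top (f := D)).comp (measurable_find hex fun k =>
    (measurableSet_frequently_dist_lt hp measurable_const δ).inter
      (measurableSet_lt (hq.dist measurable_const) measurable_const))

variable [CompleteSpace E]

theorem exists_measurable_mapClusterPt {K : Set E} (hK : IsCompact K)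
    {p : ℕ → A → E} (hp : ∀ n, Measurable (p n)) (hpK : ∀ n a, p n a ∈ K) :
    ∃ q : A → E, Measurable q ∧ ∀ a, MapClusterPt (q a) atTop fun n => p n a := by
  set r : ℝ := Metric.diam K + 1
  have hr : 0 < r := by have := Metric.diam_nonneg (s := K); linarith
  let Near (m : ℕ) (q : A → E) : Prop :=
    Measurable q ∧ ∀ a, ∃ᶠ n in atTop, dist (p n a) (q a) < r * (1 / 2) ^ m
  have hbase : Near 0 (p 0) := by
    refine ⟨hp 0, fun a => Frequently.of_forall fun n => ?_⟩
    have := Metric.dist_le_diam_of_mem hK.isBounded (hpK n a) (hpK 0 a)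
    simp only [pow_zero, mul_one]
    linarith
  have hstep (m : ℕ) (q : {q // Near m q}) : ∃ q' : {q // Near (m + 1) q},
      ∀ a, dist (q.1 a) (q'.1 a) ≤ 2 * r * (1 / 2) ^ m := by
    obtain ⟨q', hq', hfreq, hdist⟩ := exists_measurable_nearer_point hK hp hpK q.2.1
      (δ := r * (1 / 2) ^ (m + 1)) (by positivity) q.2.2
    refine ⟨⟨q', hq', hfreq⟩, fun a => (hdist a).le.trans ?_⟩
    have : 0 < r * (1 / 2) ^ m := mul_pos hr (by positivity)
    rw [pow_succ]
    linarith
  choose next hnext using hstep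
  let Q (m : ℕ) : {q // Near m q} := Nat.rec ⟨p 0, hbase⟩ next m
  choose q hq using fun a => cauchySeq_tendsto_of_complete
    (cauchySeq_of_le_geometric (1 / 2) (2 * r) (by norm_num) fun m => hnext m (Q m) a)
  refine ⟨q, measurable_of_tendsto_metrizable (fun m => (Q m).2.1) (tendsto_pi_nhds.2 hq),
    fun a => mapClusterPt_of_frequently_dist_lt (hq a) ?_ fun m => (Q m).2.2 a⟩
  simpa using (tendsto_pow_atTop_nhds_zero_of_lt_one (by norm_num)
    (by norm_num : (1 / 2 : ℝ) < 1)).const_mul r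

theorem exists_measurable_isMaxOn_iInf {K : Set E} (hK : IsCompact K)
    (hne : K.Nonempty) {G : ℕ → A → E → ℝ} (hm : ∀ n z, Measurable fun a => G n a z)
    (hc : ∀ n a, Continuous (G n a)) (hanti : ∀ a z, Antitone fun n => G n a z) :
    ∃ p : A → E, Measurable p ∧ (∀ a, p a ∈ K) ∧
      ∀ a, IsMaxOn (fun z => ⨅ n, (G n a z : EReal)) K (p a) := by
  choose p hpm hpK hpmax using fun n : ℕ =>
    exists_measurable_near_maximizer hK hne (hm n) (hc n) (Nat.one_div_pos_of_nat (α := ℝ) (n := n))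
  obtain ⟨q, hqm, hq⟩ := exists_measurable_mapClusterPt hK hpm hpK
  refine ⟨q, hqm, fun a => hK.isClosed.mem_of_mapClusterPt (hq a)
    (Eventually.of_forall fun n => hpK n a), fun a z hz => ?_⟩
  change ⨅ n, (G n a z : EReal) ≤ ⨅ n, (G n a (q a) : EReal)
  by_contra! hlt
  obtain ⟨n, hn⟩ := iInf_lt_iff.1 hlt
  obtain ⟨c, hqc, hcz⟩ := EReal.lt_iff_exists_real_btwn.1 hn
  obtain ⟨b, hqb, hbc⟩ := exists_between (EReal.coe_lt_coe_iff.1 hqc)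
  have hfreq : ∃ᶠ j in atTop, G n a (p j a) < b := mapClusterPt_iff_frequently.1 (hq a) _
    ((isOpen_lt (hc n a) continuous_const).mem_nhds hqb)
  obtain ⟨j, hjb, hnj, hj⟩ := (hfreq.and_eventually ((eventually_ge_atTop n).and
    (tendsto_one_div_add_atTop_nhds_zero_nat.eventually (gt_mem_nhds (sub_pos.2 hbc))))).exists
  have hcj : c < G j a z := EReal.coe_lt_coe_iff.1 (hcz.trans_le (iInf_le _ j))
  linarith [hpmax j a z hz, hanti a (p j a) hnj]

end Selection

section Paths

theorem concaveOn_le_secant {f : ℝ → ℝ} (hf : ConcaveOn ℝ Set.univ f) {a b y : ℝ} (hab : a < b)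
    (hy : y ≤ a) : f y ≤ f a + (f b - f a) / (b - a) * (y - a) := by
  rcases hy.eq_or_lt with rfl | hy
  · simp
  · have := hf.slope_anti_adjacent (Set.mem_univ y) (Set.mem_univ b) hy hab
    rw [le_div_iff₀ (sub_pos.2 hy)] at this
    linarith

theorem exists_linear_bound_of_lt {f : ℝ → ℝ} (hf : ConcaveOn ℝ Set.univ f) {a b : ℝ}
    (hab : a < b) (hlt : f a < f b) : ∃ δ > 0, ∃ c, ∀ y ≤ a, f y ≤ c + δ * y := by
  refine ⟨(f b - f a) / (b - a), div_pos (sub_pos.2 hlt) (sub_pos.2 hab),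
    f a - (f b - f a) / (b - a) * a, fun y hy => ?_⟩
  linarith [concaveOn_le_secant hf hab hy]

theorem eq_of_bddBelow_of_concaveOn {f : ℝ → ℝ} (hf : ConcaveOn ℝ Set.univ f) (hmono : Monotone f)
    (hb : BddBelow (Set.range f)) (x y : ℝ) : f x = f y := by
  wlog hxy : x < y generalizing x y
  · rcases (not_lt.1 hxy).eq_or_lt with rfl | h
    exacts [rfl, (this y x h).symm]
  refine (hmono hxy.le).eq_of_not_lt fun hlt => ?_
  obtain ⟨B, hB⟩ := hb
  obtain ⟨δ, hδ, c, hc⟩ := exists_linear_bound_of_lt hf hxy hlt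
  obtain ⟨z, hzx, hz⟩ : ∃ z ≤ x, z ≤ (B - c - 1) / δ := ⟨_, min_le_left _ _, min_le_right _ _⟩
  rw [le_div_iff₀ hδ] at hz
  linarith [hB (Set.mem_range_self z), hc z hzx]

theorem eventually_div_le_of_tendsto_neg {f : ℝ → ℝ} {δ a c : ℝ} (hδ : 0 < δ)
    (hf : ∀ y ≤ a, f y ≤ c + δ * y) {L Z : ℕ → ℝ} (hL : Tendsto L atTop atTop) {z : ℝ}
    (hZ : Tendsto Z atTop (𝓝 z)) (hz : z < 0) :
    ∀ᶠ n in atTop, f (L n * Z n) / L n ≤ δ * z / 2 := by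
  have hbound : Tendsto (fun n => c / L n + δ * Z n) atTop (𝓝 (0 + δ * z)) :=
    (hL.const_div_atTop c).add (hZ.const_mul δ)
  have hlt : 0 + δ * z < δ * z / 2 := by linarith [mul_neg_of_pos_of_neg hδ hz]
  filter_upwards [hbound.eventually (gt_mem_nhds hlt), hL.eventually_gt_atTop 0,
    (hL.atTop_mul_neg hz hZ).eventually_le_atBot a] with n hn hLn ha
  refine le_trans ?_ hn.le
  rw [div_add' _ _ _ hLn.ne']
  gcongr
  linarith [hf _ ha]

/-- The properties that the paths of the value functions inherit from the utility function `U`: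
monotonicity, concavity, a lower bound by `U`, and the growth bounds of `U`. -/
structure RegularPath (U : ℝ → ℝ) (γ : ℝ) (f : ℝ → ℝ) : Prop where
  mono : Monotone f
  concave : ConcaveOn ℝ Set.univ f
  ge : ∀ x, U x ≤ f x
  growth : ∀ C : ℝ, 0 < C → Growth γ C U → Growth γ C f

/-- A regular path that is unbounded below, which makes expected utility coercive. -/
structure ValuePath (U : ℝ → ℝ) (γ : ℝ) (f : ℝ → ℝ) : Prop extends RegularPath U γ f where
  not_bddBelow : ¬BddBelow (Set.range f)

/-- A utility function for which the one-period problems below are coercive. -/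
structure UnboundedUtility (U : ℝ → ℝ) (γ : ℝ) : Prop where
  mono : Monotone U
  concave : ConcaveOn ℝ Set.univ U
  not_bddBelow : ¬BddBelow (Set.range U)
  γ_lt_one : γ < 1
  exists_growth : ∃ C : ℝ, 0 < C ∧ Growth γ C U

variable {U f : ℝ → ℝ} {γ : ℝ}

theorem regularPath_self (hmono : Monotone U) (hconc : ConcaveOn ℝ Set.univ U) :
    RegularPath U γ U :=
  ⟨hmono, hconc, fun _ => le_rfl, fun _ _ => id⟩

theorem UnboundedUtility.valuePath (hU : UnboundedUtility U γ) : ValuePath U γ U :=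
  ⟨regularPath_self hU.mono hU.concave, hU.not_bddBelow⟩

theorem ValuePath.continuous (hf : ValuePath U γ f) : Continuous f :=
  continuousOn_univ.1 (hf.concave.continuousOn isOpen_univ)

theorem ValuePath.exists_linear_bound (hf : ValuePath U γ f) :
    ∃ δ > 0, ∃ a c, ∀ y ≤ a, f y ≤ c + δ * y := by
  by_contra! hcon
  refine hf.not_bddBelow ⟨f 0, Set.forall_mem_range.2 fun y => not_lt.1 fun hlt => ?_⟩
  obtain ⟨δ, hδ, c, hc⟩ := exists_linear_bound_of_lt hf.concave (hf.mono.reflect_lt hlt) hlt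
  obtain ⟨z, hz, hcz⟩ := hcon δ hδ y c
  exact (hc z hz).not_gt hcz

/-- The space of continuous paths carries the Borel `σ`-algebra of locally uniform convergence. -/
instance : MeasurableSpace C(ℝ, ℝ) := borel _

instance : BorelSpace C(ℝ, ℝ) := ⟨rfl⟩

theorem measurable_path_eval : Measurable fun a : C(ℝ, ℝ) × ℝ => a.1 a.2 :=
  continuous_eval.measurable

theorem measurable_path_iff {Ω : Type*} [MeasurableSpace Ω] {Z : Ω → C(ℝ, ℝ)} :
    Measurable Z ↔ ∀ x, Measurable fun ω => Z ω x := by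
  refine ⟨fun h x => measurable_path_eval.comp (h.prodMk measurable_const), fun h => ?_⟩
  let e : C(ℝ, ℝ) → (ℚ → ℝ) := fun f q => f q
  have he : Continuous e := continuous_pi fun q => continuous_eval_const (q : ℝ)
  have hinj : Function.Injective e := fun f g hfg =>
    DFunLike.coe_injective (Rat.denseRange_cast.equalizer f.continuous g.continuous hfg)
  exact (he.measurableEmbedding hinj).measurable_comp_iff.1 (measurable_pi_iff.2 fun q => h q)

theorem measurableSet_bddBelow_path : MeasurableSet {f : C(ℝ, ℝ) | BddBelow (Set.range f)} := by
  have : {f : C(ℝ, ℝ) | BddBelow (Set.range f)} = ⋃ n : ℕ, ⋂ x, {f | -(n : ℝ) ≤ f x} := by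
    ext f
    simp only [Set.mem_ofPred_eq, Set.mem_iUnion, Set.mem_iInter]
    refine ⟨fun ⟨B, hB⟩ => ?_, fun ⟨n, hn⟩ => ⟨-n, Set.forall_mem_range.2 hn⟩⟩
    obtain ⟨n, hn⟩ := exists_nat_ge (-B)
    exact ⟨n, fun x => (neg_le.1 hn).trans (hB (Set.mem_range_self x))⟩
  rw [this]
  exact MeasurableSet.iUnion fun n => (isClosed_iInter fun x =>
    isClosed_le continuous_const (continuous_eval_const x)).measurableSet

theorem isClosed_growth_path (γ C : ℝ) : IsClosed {f : C(ℝ, ℝ) | Growth γ C f} := by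
  simp only [Growth, Set.ofPred_forall, Set.ofPred_and]
  exact isClosed_iInter fun x => isClosed_iInter fun l => isClosed_iInter fun _ =>
    (isClosed_le (continuous_eval_const _) (((continuous_eval_const x).const_mul _).add
      continuous_const)).inter
    (isClosed_le (continuous_eval_const _) (((continuous_eval_const x).const_mul _).add
      continuous_const))

theorem isClosed_regularPath (U : ℝ → ℝ) (γ : ℝ) : IsClosed {f : C(ℝ, ℝ) | RegularPath U γ f} := by
  have hcoe : Continuous fun f : C(ℝ, ℝ) => (f : ℝ → ℝ) := continuous_pi continuous_eval_const
  have hge : IsClosed {f : C(ℝ, ℝ) | ∀ x, U x ≤ f x} := by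
    rw [Set.ofPred_forall]
    exact isClosed_iInter fun x => isClosed_le continuous_const (continuous_eval_const x)
  have hgrowth : IsClosed {f : C(ℝ, ℝ) | ∀ C : ℝ, 0 < C → Growth γ C U → Growth γ C f} := by
    simp only [Set.ofPred_forall]
    exact isClosed_iInter fun C => isClosed_iInter fun _ => isClosed_iInter fun _ =>
      isClosed_growth_path γ C
  have hiff (f : C(ℝ, ℝ)) : RegularPath U γ f ↔ Monotone f ∧ ConcaveOn ℝ Set.univ f ∧
      (∀ x, U x ≤ f x) ∧ ∀ C : ℝ, 0 < C → Growth γ C U → Growth γ C f :=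
    ⟨fun h => ⟨h.mono, h.concave, h.ge, h.growth⟩, fun ⟨hmono, hconc, hle, hgr⟩ =>
      ⟨hmono, hconc, hle, hgr⟩⟩
  simp only [hiff, Set.ofPred_and]
  exact (isClosed_monotone.preimage hcoe).inter ((isClosed_setOfPred_concaveOn.preimage hcoe).inter
    (hge.inter hgrowth))

theorem measurableSet_valuePath (U : ℝ → ℝ) (γ : ℝ) :
    MeasurableSet {f : C(ℝ, ℝ) | ValuePath U γ f} := by
  have hiff (f : C(ℝ, ℝ)) : ValuePath U γ f ↔ RegularPath U γ f ∧ ¬BddBelow (Set.range f) :=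
    ⟨fun h => ⟨h.toRegularPath, h.not_bddBelow⟩, fun ⟨hreg, hb⟩ => ⟨hreg, hb⟩⟩
  simp only [hiff, Set.ofPred_and]
  exact (isClosed_regularPath U γ).measurableSet.inter measurableSet_bddBelow_path.compl

end Paths

section Coercivity

variable {Θ : Type*} [MeasurableSpace Θ] {μ : Measure Θ}

theorem exists_subseq_ae_tendsto_zero {g : Θ → ℝ} (hg : Integrable g μ) {f : ℕ → Θ → ℝ}
    (hf : ∀ n, Integrable (f n) μ) {a c : ℕ → ℝ} (ha : Tendsto a atTop (𝓝 0))
    (hc : Tendsto c atTop (𝓝 0)) (hle : ∀ n, f n ≤ᵐ[μ] fun θ => a n * g θ)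
    (hint : ∀ n, c n ≤ ∫ θ, f n θ ∂μ) :
    ∃ φ : ℕ → ℕ, StrictMono φ ∧ ∀ᵐ θ ∂μ, Tendsto (fun n => f (φ n) θ) atTop (𝓝 0) := by
  have hgap (n : ℕ) : Integrable (fun θ => a n * g θ - f n θ) μ := (hg.const_mul _).sub (hf n)
  have hnonneg (n : ℕ) : 0 ≤ᵐ[μ] fun θ => a n * g θ - f n θ := by
    filter_upwards [hle n] with θ hθ using sub_nonneg.2 hθ
  have hnorm (n : ℕ) : eLpNorm (fun θ => a n * g θ - f n θ) 1 μ
      ≤ ENNReal.ofReal (a n * ∫ θ, g θ ∂μ - c n) := by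
    rw [eLpNorm_one_eq_lintegral_enorm, lintegral_congr_ae ((hnonneg n).mono fun θ hθ =>
      Real.enorm_of_nonneg hθ), ← ofReal_integral_eq_lintegral_ofReal (hgap n) (hnonneg n),
      integral_sub (hg.const_mul _) (hf n), integral_const_mul]
    exact ENNReal.ofReal_le_ofReal (sub_le_sub_left (hint n) _)
  have hzero : Tendsto (fun n => ENNReal.ofReal (a n * ∫ θ, g θ ∂μ - c n)) atTop (𝓝 0) := by
    simpa using ENNReal.tendsto_ofReal ((ha.mul_const _).sub hc)
  have hL1 : Tendsto (fun n => eLpNorm ((fun θ => a n * g θ - f n θ) - 0) 1 μ) atTop (𝓝 0) := by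
    simp only [sub_zero]
    exact tendsto_of_tendsto_of_tendsto_of_le_of_le tendsto_const_nhds hzero
      (fun _ => zero_le) hnorm
  obtain ⟨φ, hφ, hlim⟩ := (tendstoInMeasure_of_tendsto_eLpNorm one_ne_zero
    (fun n => (hgap n).aestronglyMeasurable) aestronglyMeasurable_zero hL1).exists_seq_tendsto_ae
  refine ⟨φ, hφ, hlim.mono fun θ hθ => ?_⟩
  simpa using ((ha.comp hφ.tendsto_atTop).mul_const (g θ)).sub hθ

theorem exists_subseq_tendsto_normalized {G : Type*} [NormedAddCommGroup G] [NormedSpace ℝ G]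
    [ProperSpace G] {w : ℕ → G} (hw : ∀ n, w n ≠ 0) :
    ∃ p : G, ‖p‖ = 1 ∧ ∃ φ : ℕ → ℕ, StrictMono φ ∧
      Tendsto (fun n => ‖w (φ n)‖⁻¹ • w (φ n)) atTop (𝓝 p) := by
  have hsphere (n : ℕ) : ‖w n‖⁻¹ • w n ∈ Metric.sphere (0 : G) 1 :=
    mem_sphere_zero_iff_norm.2 (norm_smul_inv_norm (𝕜 := ℝ) (hw n))
  obtain ⟨p, hp, φ, hφ, hlim⟩ := (isCompact_sphere (0 : G) 1).tendsto_subseq hsphere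
  exact ⟨p, mem_sphere_zero_iff_norm.1 hp, φ, hφ, hlim⟩

theorem ValuePath.div_le_of_growth {U f : ℝ → ℝ} {γ : ℝ} (hf : ValuePath U γ f) {C : ℝ}
    (hC : 0 < C) (hG : Growth γ C U) {l z b : ℝ} (hl : 1 ≤ l) (hb : f z ≤ b) :
    f (l * z) / l ≤ l ^ (γ - 1) * (b + C) := by
  have hl0 : 0 < l := one_pos.trans_le hl
  have hlγ : 0 < l ^ γ := Real.rpow_pos_of_pos hl0 γ
  rw [Real.rpow_sub_one hl0.ne', div_mul_eq_mul_div]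
  gcongr
  calc f (l * z) ≤ l ^ γ * f z + C * l ^ γ := (hf.growth C hC hG z l hl).2
    _ ≤ l ^ γ * (b + C) := by nlinarith

variable {E : Type*} [NormedAddCommGroup E] [InnerProductSpace ℝ E]

/-- The terminal wealth of the portfolio `w = (x, ξ)`, with initial capital `x` and position `ξ`,
when the price increment is `y`. -/
def wealth (w : ℝ × E) (y : E) : ℝ := w.1 + inner ℝ w.2 y

theorem wealth_add (w w' : ℝ × E) (y : E) : wealth (w + w') y = wealth w y + wealth w' y := by
  simp only [wealth, Prod.fst_add, Prod.snd_add, inner_add_left]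
  ring

theorem wealth_smul (c : ℝ) (w : ℝ × E) (y : E) : wealth (c • w) y = c * wealth w y := by
  simp only [wealth, Prod.smul_fst, Prod.smul_snd, smul_eq_mul, real_inner_smul_left, mul_add]

theorem continuous_wealth : Continuous fun a : (ℝ × E) × E => wealth a.1 a.2 :=
  continuous_fst.fst.add (continuous_fst.snd.inner continuous_snd)

theorem wealth_le_add_mul_norm {w : ℝ × E} {R : ℝ} (hw : ‖w‖ ≤ R) (y : E) :
    wealth w y ≤ R + R * ‖y‖ :=
  add_le_add ((le_abs_self _).trans ((norm_fst_le w).trans hw))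
    ((real_inner_le_norm _ _).trans
      (mul_le_mul_of_nonneg_right ((norm_snd_le w).trans hw) (norm_nonneg y)))

/-- The random value of the portfolio `w`, for the random value function `F` and price
increment `Y`. -/
def payoff (F : Θ → ℝ → ℝ) (Y : Θ → E) (w : ℝ × E) (θ : Θ) : ℝ := F θ (wealth w (Y θ))

/-- One-period absence of arbitrage, for price increments `Y` with law given by `μ`. -/
def IsArbitrageFree (μ : Measure Θ) (Y : Θ → E) : Prop :=
  ∀ p : E, (∀ᵐ θ ∂μ, 0 ≤ inner ℝ p (Y θ)) → ∀ᵐ θ ∂μ, inner ℝ p (Y θ) = 0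

/-- The positions that almost surely yield neither gain nor loss. -/
def nullPositions (μ : Measure Θ) (Y : Θ → E) : Submodule ℝ E where
  carrier := {p | ∀ᵐ θ ∂μ, inner ℝ p (Y θ) = 0}
  add_mem' {p q} hp hq := by
    rw [Set.mem_ofPred_eq] at hp hq ⊢
    filter_upwards [hp, hq] with θ hpθ hqθ
    rw [inner_add_left, hpθ, hqθ, add_zero]
  zero_mem' := by simp
  smul_mem' c p hp := by
    rw [Set.mem_ofPred_eq] at hp ⊢
    filter_upwards [hp] with θ hθ
    rw [real_inner_smul_left, hθ, mul_zero]

theorem exists_mem_orthogonal_payoff_eq [FiniteDimensional ℝ E] (μ : Measure Θ) (F : Θ → ℝ → ℝ)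
    (Y : Θ → E) (ξ : E) : ∃ η ∈ (nullPositions μ Y)ᗮ, ∀ x,
      payoff F Y (x, η) =ᵐ[μ] payoff F Y (x, ξ) := by
  obtain ⟨ζ, hζ, η, hη, rfl⟩ := (nullPositions μ Y).exists_add_mem_mem_orthogonal ξ
  refine ⟨η, hη, fun x => ?_⟩
  filter_upwards [show ∀ᵐ θ ∂μ, inner ℝ ζ (Y θ) = 0 from hζ] with θ hθ
  simp only [payoff, wealth, inner_add_left, hθ, zero_add]

theorem IsArbitrageFree.eq_zero_of_nonneg_wealth [NeZero μ] {Y : Θ → E}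
    (hY : IsArbitrageFree μ Y) {w : ℝ × E} (hw : w.1 ≤ 0) (horth : w.2 ∈ (nullPositions μ Y)ᗮ)
    (hpos : ∀ᵐ θ ∂μ, 0 ≤ wealth w (Y θ)) : w = 0 := by
  have hnull : ∀ᵐ θ ∂μ, inner ℝ w.2 (Y θ) = 0 :=
    hY w.2 (hpos.mono fun θ hθ => by rw [wealth] at hθ; linarith)
  have hsnd : w.2 = 0 := inner_self_eq_zero.1 (horth w.2 hnull)
  obtain ⟨θ, hθ⟩ := hpos.exists
  rw [wealth, hsnd, inner_zero_left, add_zero] at hθ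
  exact Prod.ext (le_antisymm hw hθ) hsnd

/-- A random value function `F` and price increment `Y` under the law `μ`, for which expected
values are finite from above and there is no arbitrage. -/
structure OnePeriodModel [MeasurableSpace E] (U : ℝ → ℝ) (γ : ℝ) (μ : Measure Θ) (F : Θ → ℝ → ℝ)
    (Y : Θ → E) : Prop where
  measurable_path : Measurable (Function.uncurry F)
  measurable_increment : Measurable Y
  valuePath : ∀ᵐ θ ∂μ, ValuePath U γ (F θ)
  lintegral_ne_top : ∀ R : ℕ, ∫⁻ θ, ENNReal.ofReal (F θ (R + R * ‖Y θ‖)) ∂μ ≠ ∞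
  isArbitrageFree : IsArbitrageFree μ Y

variable [MeasurableSpace E] {U : ℝ → ℝ} {γ : ℝ} {F : Θ → ℝ → ℝ} {Y : Θ → E}

namespace OnePeriodModel

theorem payoff_le (h : OnePeriodModel U γ μ F Y) {w : ℝ × E} {R : ℕ} (hw : ‖w‖ ≤ R) :
    ∀ᵐ θ ∂μ, payoff F Y w θ ≤ F θ (R + R * ‖Y θ‖) :=
  h.valuePath.mono fun θ hθ => hθ.mono (wealth_le_add_mul_norm hw (Y θ))

theorem lintegral_payoff_ne_top (h : OnePeriodModel U γ μ F Y) (w : ℝ × E) :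
    ∫⁻ θ, ENNReal.ofReal (payoff F Y w θ) ∂μ ≠ ∞ := by
  obtain ⟨R, hR⟩ := exists_nat_ge ‖w‖
  exact ne_top_of_le_ne_top (h.lintegral_ne_top R) (lintegral_mono_ae
    ((h.payoff_le hR).mono fun θ hθ => ENNReal.ofReal_le_ofReal hθ))

theorem integrable_bound [BorelSpace E] [IsFiniteMeasure μ]
    (h : OnePeriodModel U γ μ F Y) (R : ℕ) :
    Integrable (fun θ => max (F θ (R + R * ‖Y θ‖)) 0) μ := by
  have hm : Measurable fun θ => F θ (R + R * ‖Y θ‖) := h.measurable_path.comp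
    (measurable_id.prodMk ((h.measurable_increment.norm.const_mul _).const_add _))
  simpa using integrable_max_neg hm (h.lintegral_ne_top R) 0

end OnePeriodModel

variable [BorelSpace E] [FiniteDimensional ℝ E]

theorem measurable_payoff_prod (hF : Measurable (Function.uncurry F)) (hY : Measurable Y) :
    Measurable fun a : (ℝ × E) × Θ => payoff F Y a.1 a.2 :=
  hF.comp (measurable_snd.prodMk (continuous_wealth.measurable.comp
    (measurable_fst.prodMk (hY.comp measurable_snd))))

namespace OnePeriodModel

theorem measurable_payoff (h : OnePeriodModel U γ μ F Y) (w : ℝ × E) :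
    Measurable (payoff F Y w) :=
  (measurable_payoff_prod h.measurable_path h.measurable_increment).comp measurable_prodMk_left

theorem coe_le_eExp_payoff_iff (h : OnePeriodModel U γ μ F Y) {w : ℝ × E} {c : ℝ} :
    (c : EReal) ≤ eExp μ (payoff F Y w) ↔
      Integrable (payoff F Y w) μ ∧ c ≤ ∫ θ, payoff F Y w θ ∂μ :=
  coe_le_eExp_iff (h.measurable_payoff w) (h.lintegral_payoff_ne_top w)

variable [IsProbabilityMeasure μ]

theorem ae_nonneg_wealth_of_tendsto (h : OnePeriodModel U γ μ F Y) (hU : UnboundedUtility U γ)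
    {L : ℕ → ℝ} (hL1 : ∀ n, 1 ≤ L n) (hL : Tendsto L atTop atTop) {q : ℕ → ℝ × E}
    (hq1 : ∀ n, ‖q n‖ ≤ 1) {p : ℝ × E} (hq : Tendsto q atTop (𝓝 p)) {c : ℝ}
    (hc : ∀ n, (c : EReal) ≤ eExp μ (payoff F Y (L n • q n))) :
    ∀ᵐ θ ∂μ, 0 ≤ wealth p (Y θ) := by
  obtain ⟨C, hC, hG⟩ := hU.exists_growth
  have hL0 (n : ℕ) : 0 < L n := one_pos.trans_le (hL1 n)
  have hpay (n : ℕ) (θ : Θ) : payoff F Y (L n • q n) θ = F θ (L n * wealth (q n) (Y θ)) := by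
    rw [payoff, wealth_smul]
  have hle (n : ℕ) : (fun θ => payoff F Y (L n • q n) θ / L n) ≤ᵐ[μ]
      fun θ => L n ^ (γ - 1) * (max (F θ ((1 : ℕ) + (1 : ℕ) * ‖Y θ‖)) 0 + C) := by
    filter_upwards [h.valuePath, h.payoff_le (R := 1) ((hq1 n).trans_eq Nat.cast_one.symm)]
      with θ hθ hbound
    rw [hpay]
    exact hθ.div_le_of_growth hC hG (hL1 n) (hbound.trans (le_max_left _ _))
  have hpow : Tendsto (fun n => L n ^ (γ - 1)) atTop (𝓝 0) := by
    have := (tendsto_rpow_neg_atTop (sub_pos.2 hU.γ_lt_one)).comp hL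
    simpa only [neg_sub, Function.comp_def] using this
  obtain ⟨φ, hφ, hlim⟩ := exists_subseq_ae_tendsto_zero
    ((h.integrable_bound 1).add (integrable_const C))
    (fun n => (h.coe_le_eExp_payoff_iff.1 (hc n)).1.div_const (L n)) hpow
    (hL.const_div_atTop c) hle fun n => by
      rw [integral_div]
      exact div_le_div_of_nonneg_right (h.coe_le_eExp_payoff_iff.1 (hc n)).2 (hL0 n).le
  filter_upwards [h.valuePath, hlim] with θ hθ hθlim
  by_contra! hneg
  obtain ⟨δ, hδ, a, b, hb⟩ := hθ.exists_linear_bound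
  have hZ : Tendsto (fun n => wealth (q n) (Y θ)) atTop (𝓝 (wealth p (Y θ))) :=
    (continuous_wealth.tendsto (p, Y θ)).comp (hq.prodMk_nhds tendsto_const_nhds)
  have hev := hφ.tendsto_atTop.eventually (eventually_div_le_of_tendsto_neg hδ hb hL hZ hneg)
  have := le_of_tendsto hθlim (hev.mono fun n hn => (congrArg (· / _) (hpay _ θ)).trans_le hn)
  linarith [mul_neg_of_pos_of_neg hδ hneg]

/-- Unbounded portfolios with expected value at least `c` have, after normalization, a limit which
would be an arbitrage. -/
theorem isBounded_portfolios (h : OnePeriodModel U γ μ F Y) (hU : UnboundedUtility U γ)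
    (x₀ c : ℝ) : Bornology.IsBounded {w : ℝ × E | w.1 ≤ x₀ ∧ w.2 ∈ (nullPositions μ Y)ᗮ ∧
      (c : EReal) ≤ eExp μ (payoff F Y w)} := by
  rw [isBounded_iff_forall_norm_le]
  by_contra! hunb
  choose w hw hwn using fun n : ℕ => hunb (n + 1)
  have hw1 (n : ℕ) : 1 ≤ ‖w n‖ := by linarith [hwn n, n.cast_nonneg (α := ℝ)]
  have hw0 (n : ℕ) : w n ≠ 0 := norm_pos_iff.1 (one_pos.trans_le (hw1 n))
  have hunit (n : ℕ) : ‖‖w n‖⁻¹ • w n‖ = 1 := norm_smul_inv_norm (𝕜 := ℝ) (hw0 n)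
  obtain ⟨p, hp, φ, hφ, hlim⟩ := exists_subseq_tendsto_normalized hw0
  have hL : Tendsto (fun n => ‖w (φ n)‖) atTop atTop := by
    have : Tendsto (fun n => ‖w n‖) atTop atTop :=
      tendsto_atTop_mono (fun n => ((lt_add_one _).trans (hwn n)).le) tendsto_natCast_atTop_atTop
    exact this.comp hφ.tendsto_atTop
  have hpos := h.ae_nonneg_wealth_of_tendsto hU (fun n => hw1 (φ n)) hL
    (fun n => (hunit (φ n)).le) hlim (c := c) fun n => by
      rw [smul_inv_smul₀ (norm_ne_zero_iff.2 (hw0 _))]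
      exact (hw (φ n)).2.2
  have hfst : p.1 ≤ 0 := by
    have hbound : Tendsto (fun n => ‖w (φ n)‖⁻¹ * x₀) atTop (𝓝 0) := by
      simpa using hL.inv_tendsto_atTop.mul_const x₀
    refine le_of_tendsto_of_tendsto' ((continuous_fst.tendsto p).comp hlim) hbound fun n => ?_
    exact mul_le_mul_of_nonneg_left (hw (φ n)).1 (inv_nonneg.2 (norm_nonneg _))
  have hsnd : p.2 ∈ (nullPositions μ Y)ᗮ :=
    (nullPositions μ Y)ᗮ.closed_of_finiteDimensional.mem_of_tendsto
      ((continuous_snd.tendsto p).comp hlim)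
      (Eventually.of_forall fun n => Submodule.smul_mem _ _ (hw (φ n)).2.1)
  rw [h.isArbitrageFree.eq_zero_of_nonneg_wealth hfst hsnd hpos, norm_zero] at hp
  exact zero_ne_one hp

end OnePeriodModel

end Coercivity

section OnePeriodValue

variable {Θ : Type*} [MeasurableSpace Θ] {μ : Measure Θ}
  {E : Type*} [NormedAddCommGroup E] [InnerProductSpace ℝ E]
  {U : ℝ → ℝ} {γ : ℝ} {F : Θ → ℝ → ℝ} {Y : Θ → E}

/-- `v x` is the maximal expected value that is attainable from the initial capital `x`. -/
def IsOnePeriodValue (μ : Measure Θ) (F : Θ → ℝ → ℝ) (Y : Θ → E) (v : ℝ → ℝ) : Prop :=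
  ∀ x, IsGreatest (Set.range fun ξ : E => eExp μ (payoff F Y (x, ξ))) (v x : EReal)

theorem IsOnePeriodValue.integral_le {v : ℝ → ℝ} (hv : IsOnePeriodValue μ F Y v) {x : ℝ} {η : E}
    {k : Θ → ℝ} (hk : Integrable k μ) (hle : k ≤ᵐ[μ] payoff F Y (x, η)) : ∫ θ, k θ ∂μ ≤ v x := by
  rw [← EReal.coe_le_coe_iff, ← eExp_of_integrable hk]
  exact (eExp_mono_ae hle).trans ((hv x).2 (Set.mem_range_self η))

variable [MeasurableSpace E]

namespace IsOnePeriodValue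

variable [BorelSpace E] [FiniteDimensional ℝ E] {v : ℝ → ℝ}

theorem exists_optimal (hv : IsOnePeriodValue μ F Y v) (h : OnePeriodModel U γ μ F Y) (x : ℝ) :
    ∃ ξ, Integrable (payoff F Y (x, ξ)) μ ∧ ∫ θ, payoff F Y (x, ξ) θ ∂μ = v x := by
  obtain ⟨ξ, hξ : eExp μ (payoff F Y (x, ξ)) = v x⟩ := (hv x).1
  have hint := (h.coe_le_eExp_payoff_iff.1 hξ.ge).1
  refine ⟨ξ, hint, ?_⟩
  rwa [eExp_of_integrable hint, EReal.coe_eq_coe_iff] at hξ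

theorem monotone (hv : IsOnePeriodValue μ F Y v) (h : OnePeriodModel U γ μ F Y) :
    Monotone v := by
  intro x y hxy
  obtain ⟨ξ, hint, hval⟩ := hv.exists_optimal h x
  rw [← hval]
  refine hv.integral_le (η := ξ) hint (h.valuePath.mono fun θ hθ => hθ.mono ?_)
  simpa only [wealth, add_le_add_iff_right] using hxy

theorem concaveOn (hv : IsOnePeriodValue μ F Y v) (h : OnePeriodModel U γ μ F Y) :
    ConcaveOn ℝ Set.univ v := by
  refine ⟨convex_univ, fun x _ y _ a b ha hb hab => ?_⟩
  obtain ⟨ξ, hξ, hvx⟩ := hv.exists_optimal h x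
  obtain ⟨η, hη, hvy⟩ := hv.exists_optimal h y
  calc a • v x + b • v y
      = ∫ θ, (a * payoff F Y (x, ξ) θ + b * payoff F Y (y, η) θ) ∂μ := by
        rw [integral_add (hξ.const_mul a) (hη.const_mul b), integral_const_mul,
          integral_const_mul, hvx, hvy, smul_eq_mul, smul_eq_mul]
    _ ≤ v (a • x + b • y) := by
        refine hv.integral_le (η := a • ξ + b • η) ((hξ.const_mul a).add (hη.const_mul b)) ?_
        filter_upwards [h.valuePath] with θ hθ
        have hmix : wealth (a • x + b • y, a • ξ + b • η) (Y θ)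
            = a * wealth (x, ξ) (Y θ) + b * wealth (y, η) (Y θ) := by
          rw [← wealth_smul, ← wealth_smul, ← wealth_add]
          rfl
        rw [payoff.eq_def F Y (_, _ + _), hmix]
        exact hθ.concave.2 (Set.mem_univ _) (Set.mem_univ _) ha hb hab

end IsOnePeriodValue

variable [IsProbabilityMeasure μ]

namespace OnePeriodModel

theorem coe_le_eExp_payoff_zero (h : OnePeriodModel U γ μ F Y) (x : ℝ) :
    (U x : EReal) ≤ eExp μ (payoff F Y (x, 0)) := by
  calc (U x : EReal) = eExp μ fun _ => U x := by
        simp [eExp_of_integrable (integrable_const (U x))]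
    _ ≤ eExp μ (payoff F Y (x, 0)) := eExp_mono_ae (h.valuePath.mono fun θ hθ => by
        simpa [payoff, wealth] using hθ.ge x)

variable [BorelSpace E] [FiniteDimensional ℝ E]

theorem exists_forall_eExp_le (h : OnePeriodModel U γ μ F Y) (hU : UnboundedUtility U γ) (x : ℝ)
    {p : ℕ → E} (hp : ∀ R : ℕ, IsMaxOn (fun ξ => eExp μ (payoff F Y (x, ξ)))
      (Metric.closedBall 0 R) (p R)) :
    ∃ M, ∀ ξ, eExp μ (payoff F Y (x, ξ)) ≤ eExp μ (payoff F Y (x, p M)) := by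
  obtain ⟨B, hB⟩ := isBounded_iff_forall_norm_le.1 (h.isBounded_portfolios hU x (U x))
  obtain ⟨M, hM⟩ := exists_nat_ge B
  refine ⟨M, fun ξ => ?_⟩
  have hUp : (U x : EReal) ≤ eExp μ (payoff F Y (x, p M)) :=
    (h.coe_le_eExp_payoff_zero x).trans (hp M (Metric.mem_closedBall_self M.cast_nonneg))
  rcases le_total (eExp μ (payoff F Y (x, ξ))) (U x) with hξ | hξ
  · exact hξ.trans hUp
  obtain ⟨η, hη, heq⟩ := exists_mem_orthogonal_payoff_eq μ F Y ξ
  have hval : eExp μ (payoff F Y (x, ξ)) ≤ eExp μ (payoff F Y (x, η)) :=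
    eExp_mono_ae (heq x).symm.le
  have hnorm : ‖η‖ ≤ M :=
    (norm_snd_le (x, η)).trans ((hB (x, η) ⟨le_rfl, hη, hξ.trans hval⟩).trans hM)
  exact hval.trans (hp M (mem_closedBall_zero_iff.2 hnorm))

end OnePeriodModel

namespace IsOnePeriodValue

variable [BorelSpace E] [FiniteDimensional ℝ E] {v : ℝ → ℝ}

theorem le_mul_add (hv : IsOnePeriodValue μ F Y v) (h : OnePeriodModel U γ μ F Y) {l m b x : ℝ}
    (hl : 0 < l) (hm : 0 < m) (hF : ∀ᵐ θ ∂μ, ∀ z, F θ (l * z) ≤ m * F θ z + b) :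
    v (l * x) ≤ m * v x + b := by
  obtain ⟨ξ, hξ, hval⟩ := hv.exists_optimal h (l * x)
  have hle : (fun θ => m⁻¹ * (payoff F Y (l * x, ξ) θ - b)) ≤ᵐ[μ]
      payoff F Y (x, l⁻¹ • ξ) := by
    filter_upwards [hF] with θ hθ
    have hscale : payoff F Y (l * x, ξ) θ = F θ (l * wealth (x, l⁻¹ • ξ) (Y θ)) := by
      rw [← wealth_smul, Prod.smul_mk, smul_inv_smul₀ hl.ne', smul_eq_mul, payoff]
    rw [inv_mul_le_iff₀ hm, hscale]
    exact sub_le_iff_le_add.2 (hθ _)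
  have hgap : Integrable (fun θ => payoff F Y (l * x, ξ) θ - b) μ := hξ.sub (integrable_const b)
  have := hv.integral_le (hgap.const_mul m⁻¹) hle
  rw [integral_const_mul, integral_sub hξ (integrable_const b), hval, integral_const,
    probReal_univ, one_smul, inv_mul_le_iff₀ hm] at this
  exact sub_le_iff_le_add.1 this

theorem not_bddBelow (hv : IsOnePeriodValue μ F Y v) (h : OnePeriodModel U γ μ F Y)
    (hU : UnboundedUtility U γ) : ¬BddBelow (Set.range v) := by
  rintro ⟨c, hc⟩
  obtain ⟨B, hB⟩ := isBounded_iff_forall_norm_le.1 (h.isBounded_portfolios hU 0 c)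
  set x : ℝ := -(|B| + 1)
  have hx : |x| = |B| + 1 := by rw [abs_neg, abs_of_pos (by positivity)]
  obtain ⟨ξ, hξ⟩ := (hv x).1
  obtain ⟨η, hη, heq⟩ := exists_mem_orthogonal_payoff_eq μ F Y ξ
  have hcη : (c : EReal) ≤ eExp μ (payoff F Y (x, η)) :=
    (EReal.coe_le_coe_iff.2 (hc (Set.mem_range_self x))).trans
      (hξ.symm.le.trans (eExp_mono_ae (heq x).symm.le))
  have hnorm := (norm_fst_le (x, η)).trans
    (hB (x, η) ⟨neg_nonpos.2 (by positivity), hη, hcη⟩)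
  rw [Real.norm_eq_abs, hx] at hnorm
  linarith [le_abs_self B]

theorem valuePath (hv : IsOnePeriodValue μ F Y v) (h : OnePeriodModel U γ μ F Y)
    (hU : UnboundedUtility U γ) : ValuePath U γ v where
  mono := hv.monotone h
  concave := hv.concaveOn h
  ge x := EReal.coe_le_coe_iff.1
    ((h.coe_le_eExp_payoff_zero x).trans ((hv x).2 (Set.mem_range_self 0)))
  growth C hC hG x l hl := by
    have hl0 : 0 < l := one_pos.trans_le hl
    exact ⟨hv.le_mul_add h hl0 hl0 (h.valuePath.mono fun θ hθ z => (hθ.growth C hC hG z l hl).1),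
      hv.le_mul_add h hl0 (Real.rpow_pos_of_pos hl0 γ)
        (h.valuePath.mono fun θ hθ z => (hθ.growth C hC hG z l hl).2)⟩
  not_bddBelow := hv.not_bddBelow h hU

end IsOnePeriodValue

end OnePeriodValue

section KernelSelection

variable {B Θ : Type*} {mB : MeasurableSpace B} [MeasurableSpace Θ]

theorem measurable_integral_kernel_prod {κ : Kernel B Θ} [IsSFiniteKernel κ] {f : (ℝ × B) × Θ → ℝ}
    (hf : Measurable f) : Measurable fun a : ℝ × B => ∫ θ, f (a, θ) ∂κ a.2 := by
  simpa only [Kernel.comap_apply] using (hf.stronglyMeasurable.integral_kernel_prod_right'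
    (κ := κ.comap Prod.snd measurable_snd)).measurable

variable {E : Type*} [NormedAddCommGroup E] [InnerProductSpace ℝ E] {Y : Θ → E}

/-- The expected gain from the position `z`, truncated to `[0, 1]`. The truncation makes it a
continuous function of `z` without any integrability assumption on `Y`. -/
noncomputable def truncatedGain (μ : Measure Θ) (Y : Θ → E) (z : E) : ℝ :=
  ∫ θ, min (max (inner ℝ z (Y θ)) 0) 1 ∂μ

theorem truncatedGain_nonneg (μ : Measure Θ) (Y : Θ → E) (z : E) : 0 ≤ truncatedGain μ Y z :=
  integral_nonneg fun _ => le_min (le_max_right _ _) zero_le_one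

theorem truncatedGain_zero (μ : Measure Θ) (Y : Θ → E) : truncatedGain μ Y 0 = 0 := by
  simp [truncatedGain]

theorem norm_min_max_le_one (s : ℝ) : ‖min (max s 0) 1‖ ≤ 1 :=
  (Real.norm_of_nonneg (le_min (le_max_right _ _) zero_le_one)).trans_le (min_le_right _ _)

variable [MeasurableSpace E] [BorelSpace E] [FiniteDimensional ℝ E]

theorem measurable_truncatedGain_integrand (hY : Measurable Y) (z : E) :
    Measurable fun θ => min (max (inner ℝ z (Y θ)) 0) 1 :=
  ((measurable_const.inner hY).max measurable_const).min measurable_const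

theorem measurable_truncatedGain (κ : Kernel B Θ) (hY : Measurable Y) (z : E) :
    Measurable fun b => truncatedGain (κ b) Y z :=
  (measurable_truncatedGain_integrand hY z).stronglyMeasurable.integral_kernel.measurable

section IsFiniteMeasure

variable {μ : Measure Θ} [IsFiniteMeasure μ]

theorem truncatedGain_eq_zero_iff (hY : Measurable Y) {z : E} :
    truncatedGain μ Y z = 0 ↔ ∀ᵐ θ ∂μ, inner ℝ z (Y θ) ≤ 0 := by
  rw [truncatedGain, integral_eq_zero_iff_of_nonneg
    (f := fun θ => min (max (inner ℝ z (Y θ)) 0) 1) (fun _ => le_min (le_max_right _ _) zero_le_one)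
    (.of_bound (measurable_truncatedGain_integrand hY z).aestronglyMeasurable 1
      (Eventually.of_forall fun _ => norm_min_max_le_one _))]
  refine eventually_congr (Eventually.of_forall fun θ => ?_)
  rw [Pi.zero_apply, min_eq_iff, max_eq_right_iff]
  simpa using fun h : inner ℝ z (Y θ) ≤ 0 => h.trans zero_le_one

theorem continuous_truncatedGain (hY : Measurable Y) : Continuous (truncatedGain μ Y) :=
  continuous_of_dominated (bound := fun _ => 1)
    (fun z => (measurable_truncatedGain_integrand hY z).aestronglyMeasurable)
    (fun _ => Eventually.of_forall fun _ => norm_min_max_le_one _) (integrable_const _)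
    (Eventually.of_forall fun _ =>
      ((continuous_id.inner continuous_const).max continuous_const).min continuous_const)

theorem truncatedGain_neg_eq_zero_iff (hY : Measurable Y) {z : E} :
    truncatedGain μ Y (-z) = 0 ↔ ∀ᵐ θ ∂μ, 0 ≤ inner ℝ z (Y θ) := by
  simp only [truncatedGain_eq_zero_iff hY, inner_neg_left, neg_nonpos]

theorem isArbitrageFree_of_isMaxOn (hY : Measurable Y) {p : E}
    (hp : IsMaxOn (fun z => ⨅ n : ℕ,
      ((truncatedGain μ Y z - n * truncatedGain μ Y (-z) : ℝ) : EReal))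
      (Metric.closedBall 0 1) p) :
    (∀ᵐ θ ∂μ, 0 ≤ inner ℝ p (Y θ)) ∧
      ((∀ᵐ θ ∂μ, inner ℝ p (Y θ) = 0) → IsArbitrageFree μ Y) := by
  have hmax {q : E} (hq : q ∈ Metric.closedBall 0 1) (hloss : truncatedGain μ Y (-q) = 0) (n : ℕ) :
      truncatedGain μ Y q ≤ truncatedGain μ Y p - n * truncatedGain μ Y (-p) := by
    have : _ ≤ ⨅ n : ℕ, ((truncatedGain μ Y p - n * truncatedGain μ Y (-p) : ℝ) : EReal) := hp hq
    have := le_iInf_iff.1 this n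
    simpa only [hloss, mul_zero, sub_zero, ciInf_const, EReal.coe_le_coe_iff] using this
  have hlossless : truncatedGain μ Y (-p) = 0 := by
    refine le_antisymm (not_lt.1 fun hpos => ?_) (truncatedGain_nonneg μ Y _)
    obtain ⟨n, hn⟩ := exists_nat_gt (truncatedGain μ Y p / truncatedGain μ Y (-p))
    have := hmax (Metric.mem_closedBall_self zero_le_one)
      (by rw [neg_zero, truncatedGain_zero]) n
    rw [truncatedGain_zero] at this
    linarith [(div_lt_iff₀ hpos).1 hn]
  refine ⟨(truncatedGain_neg_eq_zero_iff hY).1 hlossless, fun hzero q hq => ?_⟩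
  have hs : 0 < (1 + ‖q‖)⁻¹ := by positivity
  have hball : (1 + ‖q‖)⁻¹ • q ∈ Metric.closedBall 0 1 := by
    rw [mem_closedBall_zero_iff, norm_smul, Real.norm_of_nonneg hs.le,
      inv_mul_le_iff₀ (by positivity)]
    linarith
  have hgain := hmax hball ((truncatedGain_neg_eq_zero_iff hY).2 (hq.mono fun θ hθ => by
    rw [real_inner_smul_left]; exact mul_nonneg hs.le hθ)) 0
  rw [(truncatedGain_eq_zero_iff hY).2 (hzero.mono fun θ hθ => hθ.le), Nat.cast_zero, zero_mul,
    sub_zero] at hgain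
  filter_upwards [hq, (truncatedGain_eq_zero_iff hY).1
    (hgain.antisymm (truncatedGain_nonneg μ Y _))] with θ hθ hθ'
  rw [real_inner_smul_left] at hθ'
  exact le_antisymm (nonpos_of_mul_nonpos_right hθ' hs) hθ

end IsFiniteMeasure

/-- A position that maximizes the truncated gain among the lossless ones in the unit ball detects
every arbitrage. Lossless positions are singled out by an infinite penalty on losses. -/
theorem exists_measurable_arbitrage (κ : Kernel B Θ) [IsFiniteKernel κ] (hY : Measurable Y) :
    ∃ p : B → E, Measurable p ∧ ∀ b, (∀ᵐ θ ∂κ b, 0 ≤ inner ℝ (p b) (Y θ)) ∧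
      ((∀ᵐ θ ∂κ b, inner ℝ (p b) (Y θ) = 0) → IsArbitrageFree (κ b) Y) := by
  obtain ⟨p, hpm, -, hp⟩ := exists_measurable_isMaxOn_iInf (isCompact_closedBall (0 : E) 1)
    ⟨0, Metric.mem_closedBall_self zero_le_one⟩
    (G := fun n b z => truncatedGain (κ b) Y z - n * truncatedGain (κ b) Y (-z))
    (fun n z => (measurable_truncatedGain κ hY z).sub
      ((measurable_truncatedGain κ hY (-z)).const_mul _))
    (fun n b => (continuous_truncatedGain hY).sub
      (((continuous_truncatedGain hY).comp continuous_neg).const_mul _))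
    (fun b z m n hmn => sub_le_sub_left (mul_le_mul_of_nonneg_right (Nat.cast_le.2 hmn)
      (truncatedGain_nonneg _ _ _)) _)
  exact ⟨p, hpm, fun b => isArbitrageFree_of_isMaxOn hY (hp b)⟩

variable {U : ℝ → ℝ} {γ : ℝ} {F : Θ → ℝ → ℝ}

namespace OnePeriodModel

theorem continuous_integral_max {μ : Measure Θ} [IsProbabilityMeasure μ]
    (h : OnePeriodModel U γ μ F Y) (n : ℕ) :
    Continuous fun w => ∫ θ, max (payoff F Y w θ) (-n) ∂μ := by
  refine continuous_iff_continuousAt.2 fun w₀ => ?_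
  obtain ⟨R, hR⟩ := exists_nat_ge (‖w₀‖ + 1)
  refine continuousAt_of_dominated (bound := fun θ => max (F θ (R + R * ‖Y θ‖)) 0 + n)
    (Eventually.of_forall fun w =>
      ((h.measurable_payoff w).max measurable_const).aestronglyMeasurable) ?_
    ((h.integrable_bound R).add (integrable_const _)) ?_
  · filter_upwards [Metric.ball_mem_nhds w₀ one_pos] with w hw
    have hwR : ‖w‖ ≤ R := by linarith [norm_le_norm_add_norm_sub' w w₀, mem_ball_iff_norm.1 hw]
    filter_upwards [h.payoff_le hwR] with θ hθ
    have h0 := le_max_right (F θ (R + R * ‖Y θ‖)) 0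
    have hle := hθ.trans (le_max_left _ 0)
    exact abs_le.2 ⟨le_trans (by linarith) (le_max_right _ _),
      max_le (by linarith [n.cast_nonneg (α := ℝ)]) (by linarith [n.cast_nonneg (α := ℝ)])⟩
  · filter_upwards [h.valuePath] with θ hθ
    exact ((hθ.continuous.comp (continuous_wealth.comp
      (continuous_id.prodMk continuous_const))).max continuous_const).continuousAt

theorem exists_measurable_isMaxOn_closedBall {κ : Kernel B Θ} [IsMarkovKernel κ]
    (h : ∀ b, OnePeriodModel U γ (κ b) F Y) (hF : Measurable (Function.uncurry F))
    (hY : Measurable Y) (R : ℕ) :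
    ∃ p : ℝ × B → E, Measurable p ∧ ∀ a, IsMaxOn (fun z => eExp (κ a.2) (payoff F Y (a.1, z)))
      (Metric.closedBall 0 R) (p a) := by
  obtain ⟨p, hpm, -, hp⟩ := exists_measurable_isMaxOn_iInf (isCompact_closedBall (0 : E) R)
    ⟨0, Metric.mem_closedBall_self R.cast_nonneg⟩
    (G := fun n (a : ℝ × B) z => ∫ θ, max (payoff F Y (a.1, z) θ) (-n) ∂κ a.2)
    (fun n z => measurable_integral_kernel_prod (((measurable_payoff_prod hF hY).comp
      ((measurable_fst.fst.prodMk measurable_const).prodMk measurable_snd)).max measurable_const))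
    (fun n a => ((h a.2).continuous_integral_max n).comp (Continuous.prodMk_right a.1))
    (fun a z m n hmn => by
      have hint := integrable_max_neg ((h a.2).measurable_payoff (a.1, z))
        ((h a.2).lintegral_payoff_ne_top _)
      exact integral_mono (hint n) (hint m) fun θ =>
        max_le_max le_rfl (neg_le_neg (Nat.cast_le.2 hmn)))
  refine ⟨p, hpm, fun a => ?_⟩
  simpa only [eExp_eq_iInf_integral_max ((h a.2).measurable_payoff _)
    ((h a.2).lintegral_payoff_ne_top _)] using hp a

theorem eExp_eq_coe_integral {μ : Measure Θ} [IsProbabilityMeasure μ]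
    (h : OnePeriodModel U γ μ F Y) {x : ℝ} {ξ : E}
    (hξ : eExp μ (payoff F Y (x, 0)) ≤ eExp μ (payoff F Y (x, ξ))) :
    eExp μ (payoff F Y (x, ξ)) = (∫ θ, payoff F Y (x, ξ) θ ∂μ : ℝ) :=
  eExp_of_integrable (h.coe_le_eExp_payoff_iff.1 ((h.coe_le_eExp_payoff_zero x).trans hξ)).1

theorem exists_measurable_forall_eExp_le {κ : Kernel B Θ} [IsMarkovKernel κ]
    (h : ∀ b, OnePeriodModel U γ (κ b) F Y) (hU : UnboundedUtility U γ)
    (hF : Measurable (Function.uncurry F)) (hY : Measurable Y) :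
    ∃ ξ : ℝ × B → E, Measurable ξ ∧ ∀ x b z,
      eExp (κ b) (payoff F Y (x, z)) ≤ eExp (κ b) (payoff F Y (x, ξ (x, b))) := by
  classical
  choose p hpm hp using exists_measurable_isMaxOn_closedBall h hF hY
  let J (R : ℕ) (a : ℝ × B) : ℝ := ∫ θ, payoff F Y (a.1, p R a) θ ∂κ a.2
  have hJ (R : ℕ) (a : ℝ × B) : eExp (κ a.2) (payoff F Y (a.1, p R a)) = J R a :=
    (h a.2).eExp_eq_coe_integral (hp R a (Metric.mem_closedBall_self R.cast_nonneg))
  have hJm (R : ℕ) : Measurable (J R) := measurable_integral_kernel_prod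
    ((measurable_payoff_prod hF hY).comp
      ((measurable_fst.fst.prodMk ((hpm R).comp measurable_fst)).prodMk measurable_snd))
  have hbest (a : ℝ × B) : ∃ M, ∀ z,
      eExp (κ a.2) (payoff F Y (a.1, z)) ≤ eExp (κ a.2) (payoff F Y (a.1, p M a)) :=
    (h a.2).exists_forall_eExp_le hU a.1 fun R => hp R a
  have hex (a : ℝ × B) : ∃ M, ∀ R, J R a ≤ J M a :=
    (hbest a).imp fun M hM R => by simpa only [hJ, EReal.coe_le_coe_iff] using hM (p R a)
  have hms (M : ℕ) : MeasurableSet {a | ∀ R, J R a ≤ J M a} := by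
    rw [Set.ofPred_forall]
    exact MeasurableSet.iInter fun R => measurableSet_le (hJm R) (hJm M)
  refine ⟨fun a => p (Nat.find (hex a)) a, Measurable.find hpm hms hex, fun x b z => ?_⟩
  obtain ⟨M, hM⟩ := hbest (x, b)
  refine (hM z).trans ?_
  rw [hJ M (x, b), hJ _ (x, b), EReal.coe_le_coe_iff]
  exact Nat.find_spec (hex (x, b)) M

theorem exists_measurable_isOnePeriodValue {κ : Kernel B Θ} [IsMarkovKernel κ]
    (h : ∀ b, OnePeriodModel U γ (κ b) F Y) (hU : UnboundedUtility U γ)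
    (hF : Measurable (Function.uncurry F)) (hY : Measurable Y) :
    ∃ (ξ : ℝ × B → E) (v : ℝ × B → ℝ), Measurable ξ ∧ Measurable v ∧
      (∀ b, IsOnePeriodValue (κ b) F Y fun x => v (x, b)) ∧
      ∀ x b, eExp (κ b) (payoff F Y (x, ξ (x, b))) = v (x, b) := by
  obtain ⟨ξ, hξm, hξ⟩ := exists_measurable_forall_eExp_le h hU hF hY
  have hv (x : ℝ) (b : B) : eExp (κ b) (payoff F Y (x, ξ (x, b)))
      = (∫ θ, payoff F Y (x, ξ (x, b)) θ ∂κ b : ℝ) := (h b).eExp_eq_coe_integral (hξ x b 0)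
  refine ⟨ξ, fun a => ∫ θ, payoff F Y (a.1, ξ a) θ ∂κ a.2, hξm, measurable_integral_kernel_prod
    ((measurable_payoff_prod hF hY).comp ((measurable_fst.fst.prodMk
      (hξm.comp measurable_fst)).prodMk measurable_snd)), fun b x => ⟨⟨_, hv x b⟩, ?_⟩, hv⟩
  rintro _ ⟨z, rfl⟩
  exact (hξ x b z).trans_eq (hv x b)

end OnePeriodModel

end KernelSelection

section ConditionalLaw

theorem measurableSet_ae_kernel {B Θ : Type*} {_ : MeasurableSpace B} [MeasurableSpace Θ]
    (κ : Kernel B Θ) [IsSFiniteKernel κ] {A : Set (B × Θ)} (hA : MeasurableSet A) :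
    MeasurableSet {b | ∀ᵐ θ ∂κ b, (b, θ) ∈ A} :=
  Kernel.measurable_kernel_prodMk_left hA.compl (measurableSet_singleton 0)

variable {Ω Θ : Type*} {m mΩ : MeasurableSpace Ω} [MeasurableSpace Θ] [StandardBorelSpace Θ]
  [Nonempty Θ] {P : Measure Ω} [IsProbabilityMeasure P] {Z : Ω → Θ}

section Observation

variable {B : Type*} {mB : MeasurableSpace B} {X : Ω → B}

theorem setLIntegral_condDistrib (hX : Measurable X) (hZ : Measurable Z) {Φ : B × Θ → ℝ≥0∞}
    (hΦ : Measurable Φ) {s : Set B} (hs : MeasurableSet s) :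
    ∫⁻ ω in X ⁻¹' s, ∫⁻ θ, Φ (X ω, θ) ∂condDistrib Z X P (X ω) ∂P
      = ∫⁻ ω in X ⁻¹' s, Φ (X ω, Z ω) ∂P := by
  have hpre : X ⁻¹' s = (fun ω => (X ω, Z ω)) ⁻¹' s ×ˢ Set.univ := by ext ω; simp
  rw [← setLIntegral_map hs hΦ.lintegral_kernel_prod_right' hX, hpre,
    ← setLIntegral_map (hs.prod .univ) hΦ (hX.prodMk hZ),
    ← compProd_map_condDistrib hZ.aemeasurable, Measure.setLIntegral_compProd hΦ hs .univ]
  simp only [Measure.restrict_univ]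

theorem ae_condDistrib_iff (hX : Measurable X) (hZ : Measurable Z) {A : Set (B × Θ)}
    (hA : MeasurableSet A) :
    (∀ᵐ ω ∂P, ∀ᵐ θ ∂condDistrib Z X P (X ω), (X ω, θ) ∈ A) ↔ ∀ᵐ ω ∂P, (X ω, Z ω) ∈ A := by
  rw [← ae_map_iff (p := (· ∈ A)) (hX.prodMk hZ).aemeasurable hA,
    ← compProd_map_condDistrib hZ.aemeasurable, Measure.ae_compProd_iff (p := (· ∈ A)) hA,
    ae_map_iff hX.aemeasurable (measurableSet_ae_kernel _ hA)]

end Observation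

/-- The regular conditional law of `Z` given the σ-algebra `m`: the conditional distribution of
`Z` given the identity map into `Ω` with the σ-algebra `m`. -/
noncomputable def condLaw (m : MeasurableSpace Ω) (P : Measure[mΩ] Ω) [IsProbabilityMeasure P]
    (Z : Ω → Θ) : Kernel[m] Ω Θ :=
  @condDistrib Ω Ω Θ _ _ _ mΩ m Z id P _

instance : IsMarkovKernel (condLaw m P Z) := by
  unfold condLaw
  infer_instance

theorem ae_condLaw_iff (hm : m ≤ mΩ) (hZ : Measurable Z) {A : Set (Ω × Θ)}
    (hA : MeasurableSet[m.prod inferInstance] A) :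
    (∀ᵐ ω ∂P, ∀ᵐ θ ∂condLaw m P Z ω, (ω, θ) ∈ A) ↔ ∀ᵐ ω ∂P, (ω, Z ω) ∈ A :=
  ae_condDistrib_iff (mB := m) (X := id) hm hZ hA

theorem lintegral_condLaw_ae_eq (hm : m ≤ mΩ) (hZ : Measurable Z) {Φ : Ω × Θ → ℝ≥0∞}
    (hΦ : Measurable[m.prod inferInstance] Φ) :
    (fun ω => ∫⁻ θ, Φ (ω, θ) ∂condLaw m P Z ω) =ᵐ[P] condLExp m P fun ω => Φ (ω, Z ω) :=
  ae_eq_condLExp hm P _ hΦ.lintegral_kernel_prod_right' fun _ hs =>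
    setLIntegral_condDistrib (mB := m) (X := id) hm hZ hΦ hs

theorem eExp_condLaw_ae_eq (hm : m ≤ mΩ) (hZ : Measurable Z) {X : Ω × Θ → ℝ}
    (hX : Measurable[m.prod inferInstance] X) :
    (fun ω => eExp (condLaw m P Z ω) fun θ => X (ω, θ)) =ᵐ[P]
      genCondExp m P fun ω => X (ω, Z ω) := by
  filter_upwards [lintegral_condLaw_ae_eq hm hZ hX.ennreal_ofReal,
    lintegral_condLaw_ae_eq hm hZ hX.neg.ennreal_ofReal] with ω hpos hneg
  exact congrArg₂ (fun a b : ℝ≥0∞ => (a : EReal) - b) hpos hneg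

end ConditionalLaw

section OneStep

/-- A scenario consists of a path of the next value function and of a price increment; this is its
path as a function. -/
def pathEval {E : Type*} (θ : C(ℝ, ℝ) × E) : ℝ → ℝ := θ.1

theorem measurable_pathEval {E : Type*} [MeasurableSpace E] :
    Measurable (Function.uncurry (pathEval (E := E))) :=
  measurable_path_eval.comp (measurable_fst.fst.prodMk measurable_snd)

theorem exists_finset_norm_le_inner (E : Type*) [NormedAddCommGroup E] [InnerProductSpace ℝ E]
    [FiniteDimensional ℝ E] : ∃ s : Finset E, ∀ y, ∃ q ∈ s, ‖y‖ ≤ inner ℝ q y := by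
  obtain ⟨t, -, ht, hcover⟩ := (isCompact_closedBall (0 : E) 2).finite_cover_balls one_pos
  refine ⟨ht.toFinset, fun y => ?_⟩
  have hball : (2 * ‖y‖⁻¹) • y ∈ Metric.closedBall (0 : E) 2 := by
    rw [mem_closedBall_zero_iff, norm_smul, norm_mul, norm_inv, norm_norm, mul_assoc,
      Real.norm_ofNat]
    exact mul_le_of_le_one_right zero_le_two (inv_mul_le_one)
  obtain ⟨q, hq, hdist⟩ := Set.mem_iUnion₂.1 (hcover hball)
  refine ⟨q, ht.mem_toFinset.2 hq, ?_⟩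
  have hy : inner ℝ ((2 * ‖y‖⁻¹) • y) y = 2 * ‖y‖ := by
    rw [real_inner_smul_left, real_inner_self_eq_norm_sq, mul_assoc, pow_two, ← mul_assoc ‖y‖⁻¹,
      inv_mul_mul_self]
  have hdiff : inner ℝ ((2 * ‖y‖⁻¹) • y - q) y ≤ ‖y‖ :=
    (real_inner_le_norm _ _).trans
      (mul_le_of_le_one_left (norm_nonneg y) (mem_ball_iff_norm.1 hdist).le)
  rw [inner_sub_left, hy] at hdiff
  linarith

variable {E : Type*} [NormedAddCommGroup E] [InnerProductSpace ℝ E] [FiniteDimensional ℝ E]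
  [MeasurableSpace E] [BorelSpace E]

theorem lintegral_ofReal_apply_norm_ne_top {Θ : Type*} [MeasurableSpace Θ] {μ : Measure Θ}
    {F : Θ → ℝ → ℝ} {Y : Θ → E} (hF : Measurable (Function.uncurry F)) (hY : Measurable Y)
    (hmono : ∀ᵐ θ ∂μ, Monotone (F θ)) {s : Finset E} (hs : ∀ y, ∃ q ∈ s, ‖y‖ ≤ inner ℝ q y)
    {r : ℝ} (hr : 0 ≤ r)
    (h : ∀ q ∈ s, ∫⁻ θ, ENNReal.ofReal (payoff F Y (r, r • q) θ) ∂μ ≠ ∞) :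
    ∫⁻ θ, ENNReal.ofReal (F θ (r + r * ‖Y θ‖)) ∂μ ≠ ∞ := by
  have hmeas (q : E) : Measurable fun θ => ENNReal.ofReal (payoff F Y (r, r • q) θ) :=
    ((measurable_payoff_prod hF hY).comp measurable_prodMk_left).ennreal_ofReal
  refine ne_top_of_le_ne_top (ENNReal.sum_ne_top.2 h) ?_
  rw [← lintegral_finsetSum _ fun q _ => hmeas q]
  refine lintegral_mono_ae (hmono.mono fun θ hθ => ?_)
  obtain ⟨q, hq, hle⟩ := hs (Y θ)
  refine (ENNReal.ofReal_le_ofReal (hθ ?_)).trans (Finset.single_le_sum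
    (f := fun q => ENNReal.ofReal (payoff F Y (r, r • q) θ)) (fun _ _ => zero_le) hq)
  rw [wealth, real_inner_smul_left]
  gcongr

/-- The optimal position `ξ x` and the resulting value `v x` for each initial capital `x`, when
the price increment is `D`, the next value function is `V` and the information is `m`. -/
structure IsOptimalStep {Ω : Type*} {mΩ : MeasurableSpace Ω} (m : MeasurableSpace Ω)
    (P : Measure[mΩ] Ω) (V : ℝ → Ω → ℝ) (D : Ω → E) (v : ℝ → Ω → ℝ) (ξ : ℝ → Ω → E) : Prop where
  measurable_value : ∀ x, Measurable[m] (v x)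
  measurable_position : Measurable[(borel ℝ).prod m] fun a : ℝ × Ω => ξ a.1 a.2
  eq : ∀ x, (fun ω => (v x ω : EReal)) =ᵐ[P]
    genCondExp m P fun ω => V (x + inner ℝ (ξ x ω) (D ω)) ω
  le : ∀ x, ∀ η : Ω → E, Measurable[m] η →
    genCondExp m P (fun ω => V (x + inner ℝ (η ω) (D ω)) ω) ≤ᵐ[P] fun ω => (v x ω : EReal)

variable {Ω : Type*} {m mΩ : MeasurableSpace Ω} {P : Measure Ω} [IsProbabilityMeasure P]
  {Z : Ω → C(ℝ, ℝ) × E} {U : ℝ → ℝ} {γ : ℝ}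

theorem measurable_payoff_position {η : Ω → E} (hη : Measurable η) (x : ℝ) :
    Measurable fun a : Ω × (C(ℝ, ℝ) × E) => payoff pathEval Prod.snd (x, η a.1) a.2 :=
  (measurable_payoff_prod measurable_pathEval measurable_snd).comp
    ((measurable_const.prodMk (hη.comp measurable_fst)).prodMk measurable_snd)

theorem ae_condLaw_valuePath (hm : m ≤ mΩ) (hZ : Measurable Z)
    (hpath : ∀ᵐ ω ∂P, ValuePath U γ (Z ω).1) :
    ∀ᵐ ω ∂P, ∀ᵐ θ ∂condLaw m P Z ω, ValuePath U γ (pathEval θ) :=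
  (ae_condLaw_iff hm hZ (A := {a | ValuePath U γ a.2.1})
    (measurable_snd.fst (measurableSet_valuePath U γ))).2 hpath

theorem ae_condLaw_lintegral_ne_top (hm : m ≤ mΩ) (hZ : Measurable Z)
    (hpath : ∀ᵐ ω ∂P, ValuePath U γ (Z ω).1)
    (hfin : ∀ (x : ℝ) (q : E), ∀ᵐ ω ∂P,
      condLExp m P (fun ω => ENNReal.ofReal (payoff pathEval Prod.snd (x, q) (Z ω))) ω < ∞) :
    ∀ᵐ ω ∂P, ∀ R : ℕ,
      ∫⁻ θ, ENNReal.ofReal (pathEval θ (R + R * ‖θ.2‖)) ∂condLaw m P Z ω ≠ ∞ := by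
  obtain ⟨s, hs⟩ := exists_finset_norm_le_inner E
  have hpos : ∀ᵐ ω ∂P, ∀ R : ℕ, ∀ q ∈ s, ∫⁻ θ, ENNReal.ofReal
      (payoff pathEval Prod.snd ((R : ℝ), (R : ℝ) • q) θ) ∂condLaw m P Z ω ≠ ∞ := by
    refine ae_all_iff.2 fun R => (ae_ball_iff s.countable_toSet).2 fun q _ => ?_
    filter_upwards [lintegral_condLaw_ae_eq hm hZ (measurable_payoff_position (mΩ := m)
      (measurable_const (a := (R : ℝ) • q)) R).ennreal_ofReal, hfin R ((R : ℝ) • q)] with ω heq hlt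
    exact (heq.trans_lt hlt).ne
  filter_upwards [ae_condLaw_valuePath hm hZ hpath, hpos] with ω hω hint R
  exact lintegral_ofReal_apply_norm_ne_top measurable_pathEval measurable_snd
    (hω.mono fun θ hθ => hθ.mono) hs R.cast_nonneg (hint R)

/-- Absence of arbitrage in the filtered market passes to almost every conditional law, because
a candidate arbitrage can be chosen measurably. -/
theorem exists_measurableSet_onePeriodModel (hm : m ≤ mΩ) (hZ : Measurable Z)
    (hpath : ∀ᵐ ω ∂P, ValuePath U γ (Z ω).1)
    (hNA : ∀ η : Ω → E, Measurable[m] η → (∀ᵐ ω ∂P, 0 ≤ inner ℝ (η ω) (Z ω).2) →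
      ∀ᵐ ω ∂P, inner ℝ (η ω) (Z ω).2 = 0)
    (hfin : ∀ (x : ℝ) (q : E), ∀ᵐ ω ∂P,
      condLExp m P (fun ω => ENNReal.ofReal (payoff pathEval Prod.snd (x, q) (Z ω))) ω < ∞) :
    ∃ A, MeasurableSet[m] A ∧ (∀ᵐ ω ∂P, ω ∈ A) ∧
      ∀ ω ∈ A, OnePeriodModel U γ (condLaw m P Z ω) pathEval Prod.snd := by
  obtain ⟨p, hpm, hp⟩ := exists_measurable_arbitrage (condLaw m P Z)
    (measurable_snd : Measurable fun θ : C(ℝ, ℝ) × E => θ.2)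
  have hgain : Measurable[m.prod inferInstance] fun a : Ω × (C(ℝ, ℝ) × E) =>
      (inner ℝ (p a.1) a.2.2 : ℝ) := (hpm.comp measurable_fst).inner measurable_snd.snd
  have hzero : ∀ᵐ ω ∂P, ∀ᵐ θ ∂condLaw m P Z ω, inner ℝ (p ω) θ.2 = 0 :=
    (ae_condLaw_iff hm hZ (hgain (measurableSet_singleton 0))).2 (hNA p hpm
      ((ae_condLaw_iff hm hZ (hgain measurableSet_Ici)).1 (.of_forall fun ω => (hp ω).1)))
  have hbound (R : ℕ) : Measurable fun θ : C(ℝ, ℝ) × E =>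
      ENNReal.ofReal (pathEval θ (R + R * ‖θ.2‖)) :=
    (measurable_pathEval.comp (measurable_id.prodMk
      (measurable_const.add (measurable_snd.norm.const_mul _)))).ennreal_ofReal
  refine ⟨{ω | ∀ᵐ θ ∂condLaw m P Z ω, ValuePath U γ (pathEval θ)} ∩
    ({ω | ∀ R : ℕ, ∫⁻ θ, ENNReal.ofReal (pathEval θ (R + R * ‖θ.2‖)) ∂condLaw m P Z ω ≠ ∞} ∩
      {ω | ∀ᵐ θ ∂condLaw m P Z ω, inner ℝ (p ω) θ.2 = 0}), ?_, ?_, ?_⟩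
  · refine .inter (measurableSet_ae_kernel _ (measurable_snd.fst (measurableSet_valuePath U γ)))
      (.inter ?_ (measurableSet_ae_kernel _ (hgain (measurableSet_singleton 0))))
    rw [Set.ofPred_forall]
    exact .iInter fun R => (hbound R).lintegral_kernel (measurableSet_singleton ∞).compl
  · exact (ae_condLaw_valuePath hm hZ hpath).and
      ((ae_condLaw_lintegral_ne_top hm hZ hpath hfin).and hzero)
  · exact fun ω ⟨hvalue, hint, hω⟩ =>
      ⟨measurable_pathEval, measurable_snd, hvalue, hint, (hp ω).2 hω⟩

theorem exists_kernel_onePeriodModel (hm : m ≤ mΩ) (hZ : Measurable Z)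
    (hpath : ∀ᵐ ω ∂P, ValuePath U γ (Z ω).1)
    (hNA : ∀ η : Ω → E, Measurable[m] η → (∀ᵐ ω ∂P, 0 ≤ inner ℝ (η ω) (Z ω).2) →
      ∀ᵐ ω ∂P, inner ℝ (η ω) (Z ω).2 = 0)
    (hfin : ∀ (x : ℝ) (q : E), ∀ᵐ ω ∂P,
      condLExp m P (fun ω => ENNReal.ofReal (payoff pathEval Prod.snd (x, q) (Z ω))) ω < ∞) :
    ∃ κ : Kernel[m] Ω (C(ℝ, ℝ) × E), IsMarkovKernel κ ∧
      (∀ ω, OnePeriodModel U γ (κ ω) pathEval Prod.snd) ∧ ∀ᵐ ω ∂P, condLaw m P Z ω = κ ω := by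
  classical
  obtain ⟨A, hAm, hA, hmodel⟩ := exists_measurableSet_onePeriodModel hm hZ hpath hNA hfin
  obtain ⟨ω₀, hω₀⟩ := hA.exists
  refine ⟨Kernel.piecewise hAm (condLaw m P Z) (@Kernel.const Ω _ m _ (condLaw m P Z ω₀)),
    inferInstance, fun ω => ?_, hA.mono fun ω hω => ?_⟩
  · rw [Kernel.piecewise_apply]
    split_ifs with hω
    exacts [hmodel ω hω, hmodel ω₀ hω₀]
  · rw [Kernel.piecewise_apply, if_pos hω]

theorem exists_isOptimalStep (hm : m ≤ mΩ) (hZ : Measurable Z) (hU : UnboundedUtility U γ)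
    (hpath : ∀ᵐ ω ∂P, ValuePath U γ (Z ω).1)
    (hNA : ∀ η : Ω → E, Measurable[m] η → (∀ᵐ ω ∂P, 0 ≤ inner ℝ (η ω) (Z ω).2) →
      ∀ᵐ ω ∂P, inner ℝ (η ω) (Z ω).2 = 0)
    (hfin : ∀ (x : ℝ) (q : E), ∀ᵐ ω ∂P,
      condLExp m P (fun ω => ENNReal.ofReal (payoff pathEval Prod.snd (x, q) (Z ω))) ω < ∞) :
    ∃ v ξ, IsOptimalStep m P (fun x ω => (Z ω).1 x) (fun ω => (Z ω).2) v ξ ∧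
      ∀ ω, ValuePath U γ fun x => v x ω := by
  obtain ⟨κ, _, hmodel, hκ⟩ := exists_kernel_onePeriodModel hm hZ hpath hNA hfin
  obtain ⟨ξ, v, hξm, hvm, hv, hopt⟩ := OnePeriodModel.exists_measurable_isOnePeriodValue hmodel hU
    measurable_pathEval measurable_snd
  have hgen {η : Ω → E} (hη : Measurable[m] η) (x : ℝ) :
      (fun ω => eExp (κ ω) (payoff pathEval Prod.snd (x, η ω))) =ᵐ[P]
        genCondExp m P fun ω => payoff pathEval Prod.snd (x, η ω) (Z ω) := by
    filter_upwards [hκ, eExp_condLaw_ae_eq hm hZ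
      (measurable_payoff_position (mΩ := m) hη x)] with ω hω heq
    rw [← heq, hω]
  refine ⟨fun x ω => v (x, ω), fun x ω => ξ (x, ω), ⟨fun x => hvm.comp measurable_prodMk_left,
    hξm, fun x => ?_, fun x η hη => ?_⟩, fun ω => (hv ω).valuePath (hmodel ω) hU⟩
  · filter_upwards [hgen (hξm.comp measurable_prodMk_left) x] with ω hω
    exact (hopt x ω).symm.trans hω
  · filter_upwards [hgen hη x] with ω hω
    exact hω.ge.trans ((hv ω x).2 (Set.mem_range_self (η ω)))

end OneStep

section BackwardInduction

variable {Ω : Type*}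

theorem measurable_genCondExp {m mΩ : MeasurableSpace Ω} (P : Measure Ω) (X : Ω → ℝ) :
    Measurable (genCondExp m P X) := by
  have hcond (Y : Ω → ℝ≥0∞) : Measurable[mΩ] fun ω => ((condLExp m P Y ω : ℝ≥0∞) : EReal) :=
    measurable_coe_ennreal_ereal.comp (measurable_condLExp' m P Y)
  exact (hcond _).sub (hcond _)

theorem genCondExp_const {m mΩ : MeasurableSpace Ω} (hm : m ≤ mΩ) (P : Measure Ω)
    [IsProbabilityMeasure P] (c : ℝ) : genCondExp m P (fun _ => c) = fun _ => (c : EReal) := by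
  funext ω
  rw [genCondExp, condLExp_const hm, condLExp_const hm]
  rcases le_total 0 c with hc | hc
  · rw [ENNReal.ofReal_of_nonpos (neg_nonpos.2 hc), EReal.coe_ennreal_ofReal, max_eq_left hc]
    simp
  · rw [ENNReal.ofReal_of_nonpos hc, EReal.coe_ennreal_ofReal, max_eq_left (neg_nonneg.2 hc)]
    simp

variable {d T : ℕ} [mΩ : MeasurableSpace Ω] {P : Measure Ω} {ℱ : Filtration ℕ mΩ}
  {S : ℕ → Ω → EuclideanSpace ℝ (Fin d)} {U : ℝ → ℝ}

theorem NoArbitrage.one_period (hNA : NoArbitrage P ℱ S T) {t : ℕ} (ht : t < T)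
    {η : Ω → EuclideanSpace ℝ (Fin d)} (hη : Measurable[ℱ t] η)
    (hpos : ∀ᵐ ω ∂P, 0 ≤ inner ℝ (η ω) (S (t + 1) ω - S t ω)) :
    ∀ᵐ ω ∂P, inner ℝ (η ω) (S (t + 1) ω - S t ω) = 0 := by
  let φ : ℕ → Ω → EuclideanSpace ℝ (Fin d) := Function.update 0 (t + 1) η
  have hφ_self : φ (t + 1) = η := Function.update_self ..
  have hφ_ne {i : ℕ} (hi : i ≠ t) : φ (i + 1) = 0 :=
    Function.update_of_ne (fun h => hi (Nat.succ_injective h)) ..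
  have hval (ω : Ω) : portfolioValue S 0 φ T ω = inner ℝ (η ω) (S (t + 1) ω - S t ω) := by
    rw [portfolioValue, zero_add, Finset.sum_eq_single_of_mem t (Finset.mem_range.2 ht)
      fun i _ hi => by rw [hφ_ne hi, Pi.zero_apply, inner_zero_left], hφ_self]
  simp only [← hval] at hpos ⊢
  refine hNA φ (fun i _ => ?_) hpos
  rcases eq_or_ne i t with rfl | hi
  · rwa [hφ_self]
  · rw [hφ_ne hi]
    exact measurable_const

/-- The value functions are finite from above: all constant positions have a conditional expected
gain smaller than `∞` in every period, whatever regular versions of the later value functions are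
taken. -/
def ValueFiniteFromAbove (P : Measure Ω) (ℱ : Filtration ℕ mΩ)
    (S : ℕ → Ω → EuclideanSpace ℝ (Fin d)) (T : ℕ) (U : ℝ → ℝ) : Prop :=
  ∀ t < T, ∀ u, IsRegularValue P ℱ S T U (t + 1) u → ∀ x, ∀ q : EuclideanSpace ℝ (Fin d),
    ∀ᵐ ω ∂P, condLExp (ℱ t) P
      (fun ω => ENNReal.ofReal (nextValue S t (u (t + 1)) x (fun _ => q) ω)) ω < ∞

theorem ValueWellPosed.valueFiniteFromAbove [IsProbabilityMeasure P]
    (h : ValueWellPosed P ℱ S T U) : ValueFiniteFromAbove P ℱ S T U := by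
  intro t ht u hu x q
  obtain ⟨G, hG⟩ := exists_isEssSupFamily P
    (f := fun ξ : {ξ : Ω → EuclideanSpace ℝ (Fin d) // Measurable[ℱ t] ξ} =>
      genCondExp (ℱ t) P (nextValue S t (u (t + 1)) x ξ.1)) fun ξ => measurable_genCondExp _ _
  filter_upwards [h.wellDefined t ht u hu x _ measurable_const, h.lt_top t ht u hu x G hG,
    hG.le ⟨fun _ => q, measurable_const⟩] with ω hdef hlt hle
  refine hdef.elim id fun hneg => lt_top_iff_ne_top.2 fun hpos => (hle.trans_lt hlt).ne ?_
  rw [genCondExp, hpos, EReal.coe_ennreal_top, sub_eq_add_neg]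
  exact EReal.top_add_of_ne_bot (by simpa using hneg.ne)

theorem IsOptimalStep.isBellmanSup {t : ℕ} {V v : ℝ → Ω → ℝ}
    {ξ : ℝ → Ω → EuclideanSpace ℝ (Fin d)}
    (h : IsOptimalStep (ℱ t) P V (fun ω => S (t + 1) ω - S t ω) v ξ) (x : ℝ) :
    IsBellmanSup P ℱ S t V x fun ω => (v x ω : EReal) where
  measurable := measurable_coe_real_ereal.comp ((h.measurable_value x).mono (ℱ.le t) le_rfl)
  le η := h.le x η.1 η.2
  least _ _ hle := (h.eq x).le.trans
    (hle ⟨ξ x, h.measurable_position.comp (measurable_const.prodMk measurable_id)⟩)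

/-- The functions `u` and positions `ξ` solve the dynamic programming recursion from time `T` back
to time `s`. -/
structure IsBackwardSolution (P : Measure Ω) (ℱ : Filtration ℕ mΩ)
    (S : ℕ → Ω → EuclideanSpace ℝ (Fin d)) (T : ℕ) (U : ℝ → ℝ) (s : ℕ)
    (u : ℕ → ℝ → Ω → ℝ) (ξ : ℕ → ℝ → Ω → EuclideanSpace ℝ (Fin d)) : Prop where
  terminal : ∀ x ω, u T x ω = U x
  isOptimalStep : ∀ t, s ≤ t → t < T →
    IsOptimalStep (ℱ t) P (u (t + 1)) (fun ω => S (t + 1) ω - S t ω) (u t) (ξ (t + 1))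

namespace IsBackwardSolution

variable {s : ℕ} {u : ℕ → ℝ → Ω → ℝ} {ξ : ℕ → ℝ → Ω → EuclideanSpace ℝ (Fin d)}

theorem measurable (h : IsBackwardSolution P ℱ S T U s u ξ) {t : ℕ} (hs : s ≤ t) (ht : t ≤ T)
    (x : ℝ) : Measurable[ℱ t] (u t x) := by
  rcases ht.eq_or_lt with rfl | ht
  · rw [funext (h.terminal x)]
    exact measurable_const
  · exact (h.isOptimalStep t hs ht).measurable_value x

theorem isRegularValue (h : IsBackwardSolution P ℱ S T U s u ξ) {γ : ℝ}
    (hpath : ∀ t, s ≤ t → t ≤ T → ∀ ω, RegularPath U γ fun x => u t x ω) :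
    IsRegularValue P ℱ S T U s u where
  terminal := h.terminal
  adapted _ hs ht := h.measurable hs ht
  mono t hs ht := .of_forall fun ω => (hpath t hs ht ω).mono
  concave t hs ht := .of_forall fun ω => (hpath t hs ht ω).concave
  bellman t hs ht := (h.isOptimalStep t hs ht).isBellmanSup

theorem update (h : IsBackwardSolution P ℱ S T U (s + 1) u ξ) (hs : s < T) {v : ℝ → Ω → ℝ}
    {η : ℝ → Ω → EuclideanSpace ℝ (Fin d)}
    (hstep : IsOptimalStep (ℱ s) P (u (s + 1)) (fun ω => S (s + 1) ω - S s ω) v η) :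
    IsBackwardSolution P ℱ S T U s (Function.update u s v) (Function.update ξ (s + 1) η) where
  terminal := by
    rw [Function.update_of_ne hs.ne']
    exact h.terminal
  isOptimalStep t hst ht := by
    rw [Function.update_of_ne (Nat.lt_succ_of_le hst).ne']
    rcases hst.eq_or_lt with rfl | hlt
    · rwa [Function.update_self, Function.update_self]
    · rw [Function.update_of_ne hlt.ne', Function.update_of_ne (Nat.succ_lt_succ hlt).ne']
      exact h.isOptimalStep t hlt ht

variable [IsProbabilityMeasure P] {γ : ℝ}

theorem exists_isOptimalStep (h : IsBackwardSolution P ℱ S T U (s + 1) u ξ)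
    (hpath : ∀ t, s + 1 ≤ t → t ≤ T → ∀ ω, ValuePath U γ fun x => u t x ω) (hs : s < T)
    (hS : ∀ t ≤ T, Measurable[ℱ t] (S t)) (hU : UnboundedUtility U γ) (hNA : NoArbitrage P ℱ S T)
    (hfin : ValueFiniteFromAbove P ℱ S T U) :
    ∃ v ξ, IsOptimalStep (ℱ s) P (u (s + 1)) (fun ω => S (s + 1) ω - S s ω) v ξ ∧
      ∀ ω, ValuePath U γ fun x => v x ω := by
  let Z (ω : Ω) : C(ℝ, ℝ) × EuclideanSpace ℝ (Fin d) :=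
    (⟨fun x => u (s + 1) x ω, (hpath (s + 1) le_rfl hs ω).continuous⟩, S (s + 1) ω - S s ω)
  have hSm {t : ℕ} (ht : t ≤ T) : Measurable (S t) := (hS t ht).mono (ℱ.le t) le_rfl
  have hZ : Measurable Z :=
    (measurable_path_iff.2 fun x => (h.measurable le_rfl hs x).mono (ℱ.le _) le_rfl).prodMk
      ((hSm hs).sub (hSm hs.le))
  exact UtilityMax.exists_isOptimalStep (Z := Z) (ℱ.le s) hZ hU
    (.of_forall (hpath (s + 1) le_rfl hs)) (fun η hη => hNA.one_period hs hη)
    (hfin s hs u (h.isRegularValue fun t hst ht ω => (hpath t hst ht ω).toRegularPath))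

end IsBackwardSolution

variable [IsProbabilityMeasure P] {γ : ℝ}

theorem exists_isBackwardSolution_of_unbounded (hS : ∀ t ≤ T, Measurable[ℱ t] (S t))
    (hU : UnboundedUtility U γ) (hNA : NoArbitrage P ℱ S T)
    (hfin : ValueFiniteFromAbove P ℱ S T U) {s : ℕ} (hs : s ≤ T) :
    ∃ u ξ, IsBackwardSolution P ℱ S T U s u ξ ∧
      ∀ t, s ≤ t → t ≤ T → ∀ ω, ValuePath U γ fun x => u t x ω := by
  induction hs using Nat.decreasingInduction with
  | self =>
    exact ⟨fun _ x _ => U x, fun _ _ _ => 0, ⟨fun _ _ => rfl, fun t hst ht => absurd hst ht.not_ge⟩,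
      fun _ _ _ _ => hU.valuePath⟩
  | of_succ s hs ih =>
    obtain ⟨u, ξ, hsol, hpath⟩ := ih
    obtain ⟨v, η, hstep, hv⟩ := hsol.exists_isOptimalStep hpath hs hS hU hNA hfin
    refine ⟨_, _, hsol.update hs hstep, fun t hst ht ω => ?_⟩
    rcases hst.eq_or_lt with rfl | hlt
    · simpa only [Function.update_self] using hv ω
    · simpa only [Function.update_of_ne hlt.ne'] using hpath t hlt ht ω

theorem isBackwardSolution_of_const (hU : ∀ x y, U x = U y) :
    IsBackwardSolution P ℱ S T U 0 (fun _ x _ => U x) fun _ _ _ => 0 where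
  terminal _ _ := rfl
  isOptimalStep t _ _ :=
    { measurable_value _ := measurable_const
      measurable_position := measurable_const
      eq x := by simp only [hU _ x, genCondExp_const (ℱ.le t)]; rfl
      le x η _ := by simp only [hU _ x, genCondExp_const (ℱ.le t)]; rfl }

theorem exists_isBackwardSolution (hS : ∀ t ≤ T, Measurable[ℱ t] (S t)) (hmono : Monotone U)
    (hconc : ConcaveOn ℝ Set.univ U) (hγ : γ < 1) (hgrowth : ∃ C : ℝ, 0 < C ∧ Growth γ C U)
    (hNA : NoArbitrage P ℱ S T) (hfin : ValueFiniteFromAbove P ℱ S T U) :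
    ∃ u ξ, IsBackwardSolution P ℱ S T U 0 u ξ ∧
      ∀ t, 0 ≤ t → t ≤ T → ∀ ω, RegularPath U γ fun x => u t x ω := by
  by_cases hb : BddBelow (Set.range U)
  · exact ⟨_, _, isBackwardSolution_of_const (eq_of_bddBelow_of_concaveOn hconc hmono hb),
      fun _ _ _ _ => regularPath_self hmono hconc⟩
  · obtain ⟨u, ξ, hsol, hpath⟩ := exists_isBackwardSolution_of_unbounded hS
      ⟨hmono, hconc, hb, hγ, hgrowth⟩ hNA hfin T.zero_le
    exact ⟨u, ξ, hsol, fun t hst ht ω => (hpath t hst ht ω).toRegularPath⟩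

end BackwardInduction

end UtilityMax

theorem proposition5p2_general {Ω : Type*} [mΩ : MeasurableSpace Ω] (P : Measure Ω)
    [IsProbabilityMeasure P] (d T : ℕ) (ℱ : Filtration ℕ mΩ)
    (S : ℕ → Ω → EuclideanSpace ℝ (Fin d)) (hS : ∀ t ≤ T, Measurable[ℱ t] (S t))
    (U : ℝ → ℝ) (γ : ℝ) (hmono : Monotone U) (hconc : ConcaveOn ℝ Set.univ U) (hγ : γ < 1)
    (hgrowth : ∃ C : ℝ, 0 < C ∧ UtilityMax.Growth γ C U) (hNA : UtilityMax.NoArbitrage P ℱ S T)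
    (hfin : UtilityMax.ValueFiniteFromAbove P ℱ S T U) :
    ∃ u : ℕ → ℝ → Ω → ℝ,
      UtilityMax.IsRegularValue P ℱ S T U 0 u ∧
      (∀ C : ℝ, 0 < C → UtilityMax.Growth γ C U →
        ∀ t ≤ T, ∀ᵐ ω ∂P, UtilityMax.Growth γ C (fun x => u t x ω)) ∧
      (∀ t ≤ T, ∀ x, ⊥ < UtilityMax.eExp P (u t x)) ∧
      (∀ t ≤ T, ∀ x, ∀ᵐ ω ∂P, (u t x ω : EReal) < ⊤) ∧
      ∃ ξ : ℕ → ℝ → Ω → EuclideanSpace ℝ (Fin d), ∀ t < T,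
        Measurable[(borel ℝ).prod (ℱ t)] (fun p : ℝ × Ω => ξ (t + 1) p.1 p.2) ∧
        ∀ x, (fun ω => (u t x ω : EReal)) =ᵐ[P]
          UtilityMax.genCondExp (ℱ t) P
            (UtilityMax.nextValue S t (u (t + 1)) x (fun ω => ξ (t + 1) x ω)) := by
  obtain ⟨u, ξ, hsol, hpath⟩ :=
    UtilityMax.exists_isBackwardSolution hS hmono hconc hγ hgrowth hNA hfin
  exact ⟨u, hsol.isRegularValue hpath,
    fun C hC hG t ht => .of_forall fun ω => (hpath t t.zero_le ht ω).growth C hC hG,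
    fun t ht x => UtilityMax.bot_lt_eExp_of_le (.of_forall fun ω => (hpath t t.zero_le ht ω).ge x),
    fun _ _ _ => .of_forall fun _ => EReal.coe_lt_top _, ξ, fun t ht =>
      ⟨(hsol.isOptimalStep t t.zero_le ht).measurable_position,
        (hsol.isOptimalStep t t.zero_le ht).eq⟩⟩

theorem proposition5p2 {Ω : Type*} [mΩ : MeasurableSpace Ω] (P : Measure Ω)
    [IsProbabilityMeasure P] (d T : ℕ) (ℱ : Filtration ℕ mΩ)
    (hnull : ∀ N : Set Ω, MeasurableSet N → P N = 0 → MeasurableSet[ℱ 0] N)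
    (S : ℕ → Ω → EuclideanSpace ℝ (Fin d)) (hS : ∀ t ≤ T, Measurable[ℱ t] (S t))
    (U : ℝ → ℝ) (xt γ : ℝ) (hU : UtilityMax.IsUtility U xt γ)
    (hNA : UtilityMax.NoArbitrage P ℱ S T)
    (hwp : UtilityMax.ValueWellPosed P ℱ S T U) :
    (∃ C : ℝ, 0 < C ∧ UtilityMax.Growth γ C U) ∧
    ∃ u : ℕ → ℝ → Ω → ℝ,
      UtilityMax.IsRegularValue P ℱ S T U 0 u ∧
      (∀ C : ℝ, 0 < C → UtilityMax.Growth γ C U →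
        ∀ t ≤ T, ∀ᵐ ω ∂P, UtilityMax.Growth γ C (fun x => u t x ω)) ∧
      (∀ t ≤ T, ∀ x, ⊥ < UtilityMax.eExp P (u t x)) ∧
      (∀ t ≤ T, ∀ x, ∀ᵐ ω ∂P, (u t x ω : EReal) < ⊤) ∧
      ∃ ξ : ℕ → ℝ → Ω → EuclideanSpace ℝ (Fin d), ∀ t < T,
        Measurable[(borel ℝ).prod (ℱ t)] (fun p : ℝ × Ω => ξ (t + 1) p.1 p.2) ∧
        ∀ x, (fun ω => (u t x ω : EReal)) =ᵐ[P]
          UtilityMax.genCondExp (ℱ t) P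
            (UtilityMax.nextValue S t (u (t + 1)) x (fun ω => ξ (t + 1) x ω)) :=
  ⟨hU.exists_growth, proposition5p2_general P d T ℱ S hS U γ hU.mono hU.concave hU.γ_lt_one
    hU.exists_growth hNA hwp.valueFiniteFromAbove⟩
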